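/- Throughout, random variables are complex, have finite variance and are identified when a.s. equal; $\mathrm{cov}(X,Y)=\mathsf E X\overline Y$. A zero-mean sequence $\zeta(n)$, $n\in\mathbb Z$, is $T$-periodically correlated ($T$-PC) if $\mathsf E\zeta(n+T)\overline{\zeta(m+T)}=\mathsf E\zeta(n)\overline{\zeta(m)}$ for all $n,m$ and $T\ge 1$ is the smallest such period. A generating sequence of $\zeta$ is a zero-mean $T$-variate stationary sequence $\vec\xi(n)=(\xi_1(n),\dots,\xi_T(n))^\top$ with $\zeta(n)=\sum_{\nu=1}^T e^{2\pi i n\nu/T}\xi_\nu(n)$. It is called a Gladyshev generating sequence if moreover $\mathsf E\xi_\nu(n+\tau)\overline{\xi_\mu(n)}=T^{-1}e^{-2\pi i\nu\tau/T}B_{\nu-\mu}(\tau)$, where $B_k(\tau)=T^{-1}\sum_{r=0}^{T-1}e^{-2\pi i k r/T}\,\mathsf E\zeta(r+\tau)\overline{\zeta(r)}$. Let $N_k,K_k\ge 0$ be integers, $N_0=K_0=0$, $M_l=\sum_{k=0}^l(N_k+K_k)$, $S=\bigcup_{l=0}^{s-1}\{M_l+1,\dots,M_l+N_{l+1}\}$,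 $a(j)\in\mathbb C$ and $A_s\zeta=\sum_{j\in S}a(j)\zeta(j)$. **Theorem.** Let $\zeta$ and $\theta$ be uncorrelated $T$-PC sequences. (a) On some extension of the probability space, $\zeta$ and $\theta$ have Gladyshev generating sequences $\vec\xi$ and $\vec\eta$ that are uncorrelated with each other. (b) Let $\vec\xi,\vec\eta$ be uncorrelated generating sequences of $\zeta,\theta$ on the given space with spectral density matrices $f=f^{\vec\xi}$, $g=f^{\vec\eta}$ (so $\mathsf E\xi_\nu(n)\overline{\xi_\mu(m)}=\frac1{2\pi}\int_{-\pi}^{\pi}e^{i(n-m)\lambda}f_{\nu\mu}(\lambda)\,d\lambda$, and likewise for $g$), and assume that $f+g$ is a.e. invertible with $\int_{-\pi}^{\pi}\mathrm{Tr}\,(f+g)^{-1}d\lambda<\infty$. Put $\vec a(j)=(a_1(j),\dots,a_T(j))^\top$, $a_\nu(j)=a(j)e^{2\pi i j\nu/T}$, $\vec a_s=(\vec a(j))_{j\in S}$, and let $\mathbf B_s,\mathbf D_s,\mathbf R_s$ be the block matrices whose $(k,j)$ block, $k,j\in S$, is $\frac1{2\pi}\int_{-\pi}^{\pi}F(\lambda)^\top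 e^{i(j-k)\lambda}d\lambda$ with $F=(f+g)^{-1}$, $F=f(f+g)^{-1}$, $F=f(f+g)^{-1}g$, respectively. Then these integrals converge absolutely and $\mathbf B_s$ is invertible. Put $\vec c_s=(\vec c(j))_{j\in S}=\mathbf B_s^{-1}\mathbf D_s\vec a_s$, $A_s(e^{i\lambda})=\sum_{j\in S}\vec a(j)e^{ij\lambda}$, $C_s(e^{i\lambda})=\sum_{j\in S}\vec c(j)e^{ij\lambda}$ and $$\vec h^\top=\big(A_s^\top f-C_s^\top\big)(f+g)^{-1}=A_s^\top-\big(A_s^\top g+C_s^\top\big)(f+g)^{-1}\quad\text{a.e.}$$ Let $L_2^{s-}(f+g)$ be the closed subspace of $L_2(f+g)$ generated by $e^{ij\lambda}\delta_\nu$, $j\in\mathbb Z\setminus S$, $1\le\nu\le T$. Then $\vec h$ is, up to a.e. equality, the unique minimizer over $\vec b\in L_2^{s-}(f+g)$ of $$\Delta(\vec b)=\tfrac1{2\pi}\int_{-\pi}^{\pi}(A_s-\vec b)^\top f\,\overline{(A_s-\vec b)}\,d\lambda+\tfrac1{2\pi}\int_{-\pi}^{\pi}\vec b^\top g\,\overline{\vec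 b}\,d\lambda .$$ The orthogonal random measures $Z^{\xi},Z^{\eta}$ of $\vec\xi,\vec\eta$ exist, and the random variable $$\widehat{A_s\zeta}=\int_{-\pi}^{\pi}\vec h^\top\,(Z^{\xi}(d\lambda)+Z^{\eta}(d\lambda))=\int_{-\pi}^{\pi}\sum_{\nu=1}^T h_\nu\,(Z^{\xi}_\nu(d\lambda)+Z^{\eta}_\nu(d\lambda))$$ is the mean square optimal linear estimate of $A_s\zeta$ from the observations $\xi_\nu(j)+\eta_\nu(j)$, $j\in\mathbb Z\setminus S$, $1\le\nu\le T$. If $\vec\xi,\vec\eta$ are Gladyshev generating sequences, it is also the mean square optimal linear estimate of $A_s\zeta$ from the observations $\zeta(j)+\theta(j)$, $j\in\mathbb Z\setminus S$. In all cases $$\mathsf E\big|A_s\zeta-\widehat{A_s\zeta}\big|^2=\Delta(\vec h)=\langle\vec a_s,\mathbf R_s\vec a_s\rangle+\langle\vec c_s,\mathbf B_s\vec c_s\rangle .$$ -/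

import Mathlib

open MeasureTheory

universe u

noncomputable section

namespace PCInterp

open scoped ComplexOrder

variable {Ω : Type u} [MeasurableSpace Ω]

/-! ### Second order sequences

A complex random variable with finite variance is an element of `Lp ℂ 2 P`. -/

/-- `E X`. -/
def mean {P : Measure Ω} (X : Lp ℂ 2 P) : ℂ := ∫ ω, X ω ∂P

/-- `E (X * conj Y)`. -/
def cov {P : Measure Ω} (X Y : Lp ℂ 2 P) : ℂ := ∫ ω, X ω * star (Y ω) ∂P

/-- `E |X - Y|^2`. -/
def meanSqError {P : Measure Ω} (X Y : Lp ℂ 2 P) : ℝ := ∫ ω, ‖X ω - Y ω‖ ^ 2 ∂P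

/-- `ζ` is periodically correlated with period `T` (and with no smaller period). -/
structure IsPC {P : Measure Ω} (T : ℕ) (ζ : ℤ → Lp ℂ 2 P) : Prop where
  pos : 0 < T
  mean_zero : ∀ n, mean (ζ n) = 0
  periodic : ∀ n m : ℤ, cov (ζ (n + T)) (ζ (m + T)) = cov (ζ n) (ζ m)
  minimal : ∀ T' : ℕ, 0 < T' → T' < T →
    ¬ ∀ n m : ℤ, cov (ζ (n + T')) (ζ (m + T')) = cov (ζ n) (ζ m)

/-- A `T`-variate (weakly) stationary sequence. -/
structure IsStationary {P : Measure Ω} {T : ℕ} (ξ : ℤ → Fin T → Lp ℂ 2 P) : Prop where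
  mean_zero : ∀ n ν, mean (ξ n ν) = 0
  shift : ∀ (n m k : ℤ) (ν μ : Fin T),
    cov (ξ (n + k) ν) (ξ (m + k) μ) = cov (ξ n ν) (ξ m μ)

/-- `exp (2 π i n ν / T)`; the index `ν : Fin T` stands for the number `ν + 1` of `1, …, T`. -/
def rootChar (T : ℕ) (n : ℤ) (ν : Fin T) : ℂ :=
  Complex.exp (2 * Real.pi * Complex.I * n * ((ν : ℕ) + 1 : ℂ) / T)

/-- `ξ` is a generating sequence of `ζ`: it is a stationary `T`-variate sequence and
`ζ n = ∑ ν, exp (2 π i n ν / T) * ξ_ν n`. -/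
structure IsGenerating {P : Measure Ω} {T : ℕ}
    (ζ : ℤ → Lp ℂ 2 P) (ξ : ℤ → Fin T → Lp ℂ 2 P) : Prop where
  stationary : IsStationary ξ
  repr : ∀ n, ζ n = ∑ ν : Fin T, rootChar T n ν • ξ n ν

/-- The cyclic covariance `B_k(τ) = T⁻¹ ∑_{r mod T} exp (-2 π i k r / T) * E ζ(r+τ) conj ζ(r)`
of a `T`-periodically correlated sequence. -/
def cyclicCov {P : Measure Ω} (T : ℕ) (ζ : ℤ → Lp ℂ 2 P) (k τ : ℤ) : ℂ :=
  (T : ℂ)⁻¹ * ∑ r ∈ Finset.range T,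
    Complex.exp (-(2 * Real.pi * Complex.I * k * r / T)) * cov (ζ (r + τ)) (ζ r)

/-- `ξ` is a generating sequence of `ζ` whose covariance is Gladyshev's matrix function
`R_{νμ}(τ) = T⁻¹ exp (-2 π i ν τ / T) B_{ν-μ}(τ)`. -/
structure IsGladyshevGenerating {P : Measure Ω} {T : ℕ}
    (ζ : ℤ → Lp ℂ 2 P) (ξ : ℤ → Fin T → Lp ℂ 2 P) : Prop extends IsGenerating ζ ξ where
  covariance : ∀ (n m : ℤ) (ν μ : Fin T), cov (ξ n ν) (ξ m μ) =
    (T : ℂ)⁻¹ * rootChar T (-(n - m)) ν * cyclicCov T ζ ((ν : ℤ) - (μ : ℤ)) (n - m)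

/-- The lift of a random variable along a measure preserving map (an extension of the
probability space). -/
def lift {Ω' : Type u} [MeasurableSpace Ω'] {P' : Measure Ω'} {P : Measure Ω} (p : Ω' → Ω)
    (hp : MeasurePreserving p P' P) (X : Lp ℂ 2 P) : Lp ℂ 2 P' :=
  Lp.compMeasurePreserving p hp X

/-! ### The set of missing observations -/

/-- `M_l = ∑_{k=0}^{l} (N_k + K_k)`. -/
def blockStart (N K : ℕ → ℕ) (l : ℕ) : ℕ := ∑ k ∈ Finset.range (l + 1), (N k + K k)

/-- The block `{M_l + 1, …, M_l + N_{l+1}}`. -/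
def block (N K : ℕ → ℕ) (l : ℕ) : Finset ℤ :=
  Finset.Icc ((blockStart N K l : ℤ) + 1) ((blockStart N K l : ℤ) + N (l + 1))

/-- `S = ⋃_{l=0}^{s-1} {M_l + 1, …, M_l + N_{l+1}}`. -/
def missing (s : ℕ) (N K : ℕ → ℕ) : Finset ℤ := (Finset.range s).biUnion (block N K)

/-- The blocks are disjoint, so a sum over `S` is the double sum over the blocks. -/
theorem sum_missing {E : Type*} [AddCommMonoid E] (s : ℕ) (N K : ℕ → ℕ) (g : ℤ → E) :
    ∑ j ∈ missing s N K, g j = ∑ l ∈ Finset.range s, ∑ j ∈ block N K l, g j := by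
  have key : ∀ l l' : ℕ, l < l' → blockStart N K l + N (l + 1) ≤ blockStart N K l' := by
    intro l l' h
    have h1 : blockStart N K (l + 1) ≤ blockStart N K l' := by
      unfold blockStart
      exact Finset.sum_le_sum_of_subset (Finset.range_mono (by omega))
    have h2 : blockStart N K (l + 1) = blockStart N K l + (N (l + 1) + K (l + 1)) := by
      unfold blockStart
      rw [Finset.sum_range_succ]
    omega
  unfold missing
  refine Finset.sum_biUnion ?_
  intro l _ l' _ hne
  refine Finset.disjoint_left.mpr ?_
  intro j hj hj'
  simp only [block, Finset.mem_Icc] at hj hj'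
  rcases lt_or_gt_of_ne hne with h | h
  · have := key l l' h
    omega
  · have := key l' l h
    omega

/-- `A_s ζ = ∑_{j ∈ S} a(j) ζ(j)`. -/
def functional {P : Measure Ω} (S : Finset ℤ) (a : ℤ → ℂ) (ζ : ℤ → Lp ℂ 2 P) : Lp ℂ 2 P :=
  ∑ j ∈ S, a j • ζ j

/-! ### Linear estimates -/

/-- The closed linear subspace of `L²(P)` generated by the random variables in `G`. -/
def closedSpan {P : Measure Ω} (G : Set (Lp ℂ 2 P)) : Submodule ℂ (Lp ℂ 2 P) :=
  (Submodule.span ℂ G).topologicalClosure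

/-- `Y` is the mean square optimal linear estimate of `X` from the observations `G`. -/
def IsOptimalLinearEstimate {P : Measure Ω} (G : Set (Lp ℂ 2 P)) (X Y : Lp ℂ 2 P) : Prop :=
  Y ∈ closedSpan G ∧ ∀ Y' ∈ closedSpan G, meanSqError X Y ≤ meanSqError X Y'

/-! ### Spectral densities and the space `L₂(f)` -/

/-- Lebesgue measure on `(-π, π]`. -/
def freq : Measure ℝ := volume.restrict (Set.Ioc (-Real.pi) Real.pi)

/-- `exp (i n x)`. -/
def expo (n : ℤ) (x : ℝ) : ℂ := Complex.exp (Complex.I * n * x)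

/-- `f` is the spectral density matrix of `ξ`:
`E ξ_ν(n) conj ξ_μ(m) = (2π)⁻¹ ∫ exp (i (n - m) x) f_{νμ}(x) dx`. -/
structure HasSpectralDensity {P : Measure Ω} {T : ℕ}
    (ξ : ℤ → Fin T → Lp ℂ 2 P) (f : ℝ → Matrix (Fin T) (Fin T) ℂ) : Prop where
  integrable : ∀ ν μ, Integrable (fun x => f x ν μ) freq
  posSemidef : ∀ᵐ x ∂freq, (f x).PosSemidef
  cov_eq : ∀ (n m : ℤ) (ν μ : Fin T),
    cov (ξ n ν) (ξ m μ) = (2 * Real.pi : ℂ)⁻¹ * ∫ x, expo (n - m) x * f x ν μ ∂freq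

/-- The minimality condition: `f` is a.e. invertible and `∫ Tr f(x)⁻¹ dx < ∞`. -/
structure Minimality {T : ℕ} (f : ℝ → Matrix (Fin T) (Fin T) ℂ) : Prop where
  invertible : ∀ᵐ x ∂freq, IsUnit (f x)
  trace_integrable : Integrable (fun x => ((f x)⁻¹).trace) freq

/-- `h(x)ᵀ f(x) conj h(x)`. -/
def quad {T : ℕ} (f : ℝ → Matrix (Fin T) (Fin T) ℂ) (h : ℝ → Fin T → ℂ) (x : ℝ) : ℂ :=
  h x ⬝ᵥ (f x).mulVec (star (h x))

/-- Membership in `L₂(f)`. -/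
def MemL2 {T : ℕ} (f : ℝ → Matrix (Fin T) (Fin T) ℂ) (h : ℝ → Fin T → ℂ) : Prop :=
  AEStronglyMeasurable h freq ∧ Integrable (quad f h) freq

/-- `(2π)⁻¹ ∫ hᵀ f conj h`. -/
def normSq {T : ℕ} (f : ℝ → Matrix (Fin T) (Fin T) ℂ) (h : ℝ → Fin T → ℂ) : ℝ :=
  (2 * Real.pi)⁻¹ * ∫ x, (quad f h x).re ∂freq

/-- The function `exp (i j x) δ_ν`. -/
def expoVec {T : ℕ} (j : ℤ) (ν : Fin T) : ℝ → Fin T → ℂ := fun x => Pi.single ν (expo j x)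

/-- Membership in `L₂^{s-}(f)`, the closed subspace of `L₂(f)` generated by the functions
`exp (i j x) δ_ν` with `j ∉ S`. -/
def MemL2Minus {T : ℕ} (S : Finset ℤ) (f : ℝ → Matrix (Fin T) (Fin T) ℂ)
    (h : ℝ → Fin T → ℂ) : Prop :=
  MemL2 f h ∧ ∀ ε : ℝ, 0 < ε →
    ∃ p ∈ Submodule.span ℂ {q : ℝ → Fin T → ℂ | ∃ j : ℤ, j ∉ S ∧ ∃ ν, q = expoVec j ν},
      normSq f (h - p) < ε

/-! ### Random measures and stochastic integrals -/

/-- `Y = ∫ hᵀ dZ`, the limit in mean square of the integrals of step functions that converge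
to `h` in `L₂(f)`, where `f` is the density of the structure matrix of `Z`. -/
def IsStochIntegral {P : Measure Ω} {T : ℕ} (f : ℝ → Matrix (Fin T) (Fin T) ℂ)
    (Z : Set ℝ → Fin T → Lp ℂ 2 P) (h : ℝ → Fin T → ℂ) (Y : Lp ℂ 2 P) : Prop :=
  MemL2 f h ∧ ∀ ε : ℝ, 0 < ε →
    ∃ (m : ℕ) (Δ : Fin m → Set ℝ) (v : Fin m → Fin T → ℂ),
      (∀ i, MeasurableSet (Δ i)) ∧
      normSq f (h - fun x => ∑ i, (Δ i).indicator (fun _ => v i) x) < ε ∧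
      meanSqError Y (∑ i, ∑ ν, v i ν • Z (Δ i) ν) < ε

/-- `Z` is the orthogonal random measure of the stationary sequence `ξ` with spectral density
`f`. (Countable additivity in mean square follows from additivity and `cov_eq`.) -/
structure IsSpectralRandomMeasure {P : Measure Ω} {T : ℕ} (ξ : ℤ → Fin T → Lp ℂ 2 P)
    (f : ℝ → Matrix (Fin T) (Fin T) ℂ) (Z : Set ℝ → Fin T → Lp ℂ 2 P) : Prop where
  mean_zero : ∀ Δ, MeasurableSet Δ → ∀ ν, mean (Z Δ ν) = 0
  additive : ∀ Δ₁ Δ₂, MeasurableSet Δ₁ → MeasurableSet Δ₂ → Disjoint Δ₁ Δ₂ →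
    Z (Δ₁ ∪ Δ₂) = Z Δ₁ + Z Δ₂
  cov_eq : ∀ Δ₁ Δ₂, MeasurableSet Δ₁ → MeasurableSet Δ₂ → ∀ ν μ,
    cov (Z Δ₁ ν) (Z Δ₂ μ) = (2 * Real.pi : ℂ)⁻¹ * ∫ x in Δ₁ ∩ Δ₂, f x ν μ ∂freq
  repr : ∀ n ν, IsStochIntegral f Z (expoVec n ν) (ξ n ν)

/-! ### The formulas -/

/-- The vector coefficients `a_ν(j) = a(j) exp (2 π i j ν / T)`. -/
def vecCoeff (T : ℕ) (a : ℤ → ℂ) (j : ℤ) : Fin T → ℂ := fun ν => a j * rootChar T j ν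

/-- The trigonometric polynomial `∑_{j ∈ S} b(j) exp (i j x)` of a block vector `b`. -/
def trigPoly {T : ℕ} {S : Finset ℤ} (b : S × Fin T → ℂ) (x : ℝ) : Fin T → ℂ :=
  fun ν => ∑ j : S, b (j, ν) * expo j x

/-- The block matrix with the blocks
`(2π)⁻¹ ∫ F(x)ᵀ exp (i (j - k) x) dx`, `k, j ∈ S`. -/
def blockMatrix {T : ℕ} (S : Finset ℤ) (F : ℝ → Matrix (Fin T) (Fin T) ℂ) :
    Matrix (S × Fin T) (S × Fin T) ℂ :=
  Matrix.of fun k j =>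
    (2 * Real.pi : ℂ)⁻¹ * ∫ x, (F x).transpose k.2 j.2 * expo ((j.1 : ℤ) - (k.1 : ℤ)) x ∂freq

section Formulas

variable {T : ℕ} (S : Finset ℤ) (a : ℤ → ℂ) (f g : ℝ → Matrix (Fin T) (Fin T) ℂ)

/-- The block vector `a_s`. -/
def aVec : S × Fin T → ℂ := fun p => vecCoeff T a p.1 p.2

/-- `B_s`. -/
def matB : Matrix (S × Fin T) (S × Fin T) ℂ := blockMatrix S fun x => (f x + g x)⁻¹

/-- `D_s`. -/
def matD : Matrix (S × Fin T) (S × Fin T) ℂ := blockMatrix S fun x => f x * (f x + g x)⁻¹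

/-- `R_s`. -/
def matR : Matrix (S × Fin T) (S × Fin T) ℂ :=
  blockMatrix S fun x => f x * (f x + g x)⁻¹ * g x

/-- `c_s = B_s⁻¹ D_s a_s`. -/
def cVec : S × Fin T → ℂ := (matB S f g)⁻¹.mulVec ((matD S f g).mulVec (aVec S a))

/-- `hᵀ = (A_sᵀ f - C_sᵀ) (f + g)⁻¹`. -/
def specChar (x : ℝ) : Fin T → ℂ :=
  Matrix.vecMul (Matrix.vecMul (trigPoly (aVec S a) x) (f x) - trigPoly (cVec S a f g) x)
    (f x + g x)⁻¹

/-- `⟨a_s, R_s a_s⟩ + ⟨c_s, B_s c_s⟩`. -/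
def errorValue : ℂ :=
  star (aVec S a) ⬝ᵥ (matR S f g).mulVec (aVec S a) +
    star (cVec S a f g) ⬝ᵥ (matB S f g).mulVec (cVec S a f g)

/-- The mean square error of the estimate with spectral characteristic `h`,
`(2π)⁻¹ ∫ (A_s - h)ᵀ f conj (A_s - h) + (2π)⁻¹ ∫ hᵀ g conj h`. -/
def specError (h : ℝ → Fin T → ℂ) : ℝ := normSq f (trigPoly (aVec S a) - h) + normSq g h

/-- `h` is a spectral characteristic of the optimal estimate: it minimizes the mean square error
over `L₂^{s-}(f + g)`. -/
def IsSpectralCharacteristic (h : ℝ → Fin T → ℂ) : Prop :=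
  MemL2Minus S (f + g) h ∧
    ∀ h', MemL2Minus S (f + g) h' → specError S a f g h ≤ specError S a f g h'

end Formulas

end PCInterp

end

open PCInterp

noncomputable section

namespace PCInterp

open scoped ComplexOrder

/-! ### Fourier coefficients of integrable functions -/

/-! The estimation problem is a projection problem in L₂(f + g). Since ξ and η are uncorrelated, ξ +
η has spectral density f + g. The exponentials e^{ijλ}δ_ν and the variables ξ_ν(j) + η_ν(j)
therefore have the same Gram matrix, and L₂(f + g) embeds isometrically in L²(P)
(`HasSpectralDensity.exists_iso`). All the spaces L₂(f) are realized in one vector-valued L² space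
through h ↦ hᵀ√f.

If the whole of ξ + η were observed, the best estimate of A_s ζ would have the characteristic p =
A_sᵀ f (f + g)⁻¹ (`pairing_fullChar`), with error ⟨a, R a⟩. Any q = Cᵀ(f + g)⁻¹ with C a
trigonometric polynomial with frequencies in S is orthogonal to L₂^{s-}(f + g), because the weight
cancels the inverse (`pairing_gapChar`). So p - q is the projection of p as soon as it lies in
L₂^{s-}(f + g). By duality it is enough that its Fourier coefficients vanish on S
(`IsWeight.emb_mem_closure_expo_compl`), which is the linear system B c = D a. B is the Gram matrix
of an a.e. invertible weight, hence invertible (`isUnit_matB`). Pythagoras then adds ‖q‖² = ⟨c, B c⟩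
to the error and gives minimality and uniqueness at once (`specError_eq_add`). The integrals
converge by entrywise bounds through Tr f and Tr (f + g)⁻¹.

An orthogonal random measure is the image of the step functions under the isometry. Density of
exponentials and of step functions gives existence, uniqueness and the integral representation.

Gladyshev sequences are discrete Fourier transforms of T orthogonal copies of ζ, obtained by
multiplying by characters of an independent uniform variable. Their components are spanned by ζ(n)
and by combinations uncorrelated with all of ζ (`IsGladyshevGenerating.inner_eq_zero`,
`component_eq_sum`). The extra information in ξ + η is thus useless for estimating A_s ζ, and the
projections on the two observation spaces coincide. -/

theorem continuous_expo (n : ℤ) : Continuous (expo n) := by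
  unfold expo; fun_prop

theorem norm_expo (n : ℤ) (x : ℝ) : ‖expo n x‖ = 1 := by
  have : Complex.I * n * x = ((n * x : ℝ) : ℂ) * Complex.I := by push_cast; ring
  rw [expo, this, Complex.norm_exp_ofReal_mul_I]

theorem expo_add (m n : ℤ) (x : ℝ) : expo (m + n) x = expo m x * expo n x := by
  simp only [expo, ← Complex.exp_add]; push_cast; ring_nf

theorem expo_zero (x : ℝ) : expo 0 x = 1 := by simp [expo]

theorem star_expo (n : ℤ) (x : ℝ) : star (expo n x) = expo (-n) x := by
  simp only [expo, Complex.star_def, ← Complex.exp_conj]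
  simp

instance : IsFiniteMeasure freq := by unfold freq; infer_instance

theorem integrable_expo_mul {f : ℝ → ℂ} (hf : Integrable f freq) (n : ℤ) :
    Integrable (fun x => expo n x * f x) freq :=
  hf.bdd_mul (c := 1) (continuous_expo n).aestronglyMeasurable (by simp [norm_expo])

theorem integral_expo (n : ℤ) : ∫ x, expo n x ∂freq = if n = 0 then (2 * Real.pi : ℂ) else 0 := by
  have hle : -Real.pi ≤ Real.pi := by linarith [Real.pi_pos]
  rw [freq, ← intervalIntegral.integral_of_le hle]
  split_ifs with h
  · subst h
    simp [expo_zero]; ring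
  · have hn : (Complex.I * n : ℂ) ≠ 0 := by simp [h]
    have := integral_exp_mul_complex (a := -Real.pi) (b := Real.pi) hn
    simp only [expo, this]
    rw [div_eq_zero_iff]; left
    rw [sub_eq_zero, Complex.exp_eq_exp_iff_exists_int]
    exact ⟨n, by push_cast; ring⟩

instance : Fact (0 < 2 * Real.pi) := ⟨Real.two_pi_pos⟩

/-- An integrable function on `(-π, π]` whose Fourier coefficients vanish is zero. -/
theorem ae_eq_zero_of_fourier {f : ℝ → ℂ} (hf : Integrable f freq)
    (h : ∀ n : ℤ, ∫ x, expo n x * f x ∂freq = 0) : f =ᵐ[freq] 0 := by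
  have hbd : ∀ φ : C(AddCircle (2 * Real.pi), ℂ),
      Integrable (fun x : ℝ => φ (x : AddCircle (2 * Real.pi)) * f x) freq := fun φ =>
    hf.bdd_mul (c := ‖φ‖) (by fun_prop) (by filter_upwards with x using φ.norm_coe_le_norm _)
  -- Integration against f is a functional on continuous functions on the circle, bounded by the L¹
  -- norm of f. It kills the dense span of the exponentials, hence everything.
  let L : C(AddCircle (2 * Real.pi), ℂ) →L[ℂ] ℂ := LinearMap.mkContinuous
    { toFun := fun φ => ∫ x : ℝ, φ (x : AddCircle (2 * Real.pi)) * f x ∂freq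
      map_add' := fun φ ψ => by
        simp only [ContinuousMap.add_apply, add_mul]
        exact integral_add (hbd φ) (hbd ψ)
      map_smul' := fun c φ => by
        simp only [ContinuousMap.smul_apply, smul_eq_mul, mul_assoc, RingHom.id_apply]
        exact integral_const_mul _ _ } (∫ x, ‖f x‖ ∂freq) (fun φ => by
      rw [← integral_mul_const]
      refine norm_integral_le_of_norm_le (hf.norm.mul_const _) ?_
      filter_upwards with x
      rw [norm_mul, mul_comm]
      gcongr
      exact φ.norm_coe_le_norm _)
  have hL : ∀ φ, L φ = 0 := by
    have h1 : (Submodule.span ℂ (Set.range (fourier (T := 2 * Real.pi)))).topologicalClosure ≤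
        LinearMap.ker (L : C(AddCircle (2 * Real.pi), ℂ) →ₗ[ℂ] ℂ) := by
      refine Submodule.topologicalClosure_minimal _ ?_ L.isClosed_ker
      rw [Submodule.span_le]
      rintro _ ⟨n, rfl⟩
      change ∫ x : ℝ, fourier n (x : AddCircle (2 * Real.pi)) * f x ∂freq = 0
      rw [← h n]
      refine integral_congr_ae ?_
      filter_upwards with x
      rw [fourier_coe_apply, expo]
      congr 2
      have := Real.pi_ne_zero
      push_cast; field_simp
    intro φ
    have := h1 (x := φ) (by rw [span_fourier_closure_eq_top]; trivial)
    exact this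
  -- Test functions supported in the open interval vanish at both endpoints, so they descend to
  -- continuous functions on the circle. The endpoint π itself is a null set.
  have hU : ∀ᵐ x, x ∈ Set.Ioo (-Real.pi) Real.pi → f x = 0 := by
    refine isOpen_Ioo.ae_eq_zero_of_integral_contDiff_smul_eq_zero ?_ ?_
    · refine IntegrableOn.locallyIntegrableOn ?_
      exact IntegrableOn.mono_set hf Set.Ioo_subset_Ioc_self
    · intro g hg _ hgs
      have hend : ∀ x, x ∉ Set.Ioo (-Real.pi) Real.pi → g x = 0 := fun x hx =>
        image_eq_zero_of_notMem_tsupport (fun hx' => hx (hgs hx'))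
      have e1 : g (-Real.pi) = 0 := hend _ (by simp)
      have e2 : g Real.pi = 0 := hend _ (by simp)
      have hpp : -Real.pi + 2 * Real.pi = Real.pi := by ring
      let φ : C(AddCircle (2 * Real.pi), ℂ) :=
        ⟨AddCircle.liftIoc (2 * Real.pi) (-Real.pi) (fun x => (g x : ℂ)),
          AddCircle.liftIoc_continuous (by simp [hpp, e1, e2])
            (Complex.continuous_ofReal.comp hg.continuous).continuousOn⟩
      have h0 := hL φ
      change ∫ x : ℝ, φ (x : AddCircle (2 * Real.pi)) * f x ∂freq = 0 at h0
      rw [← h0, freq, ← integral_indicator measurableSet_Ioc]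
      refine integral_congr_ae ?_
      filter_upwards with x
      by_cases hx : x ∈ Set.Ioc (-Real.pi) Real.pi
      · rw [Set.indicator_of_mem hx]
        have : φ (x : AddCircle (2 * Real.pi)) = g x :=
          AddCircle.liftIoc_coe_apply (f := fun x => (g x : ℂ)) (by rwa [hpp])
        simp [this]
      · rw [Set.indicator_of_notMem hx, hend x (fun h => hx (Set.Ioo_subset_Ioc_self h))]
        simp
  unfold freq
  rw [← Measure.restrict_congr_set Ioo_ae_eq_Ioc]
  exact (ae_restrict_iff' measurableSet_Ioo).2 hU

/-- An integrable function on `(-π, π]` whose Fourier coefficients vanish off the finite set `S`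
is a trigonometric polynomial. -/
theorem ae_eq_trig_of_fourier {f : ℝ → ℂ} (hf : Integrable f freq) (S : Finset ℤ)
    (h : ∀ n : ℤ, n ∉ S → ∫ x, expo (-n) x * f x ∂freq = 0) :
    ∃ c : ℤ → ℂ, f =ᵐ[freq] fun x => ∑ j ∈ S, c j * expo j x := by
  set c : ℤ → ℂ := fun j => (2 * Real.pi : ℂ)⁻¹ * ∫ x, expo (-j) x * f x ∂freq
  refine ⟨c, ?_⟩
  have hint : ∀ (j : ℤ), Integrable (fun x => c j * expo j x) freq := fun j => by
    simpa [mul_comm] using integrable_expo_mul (integrable_const (c j)) j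
  have hsum : Integrable (fun x => ∑ j ∈ S, c j * expo j x) freq :=
    integrable_finsetSum _ fun j _ => hint j
  have key := ae_eq_zero_of_fourier (hf.sub hsum) (fun n => by
    have e : ∀ x, expo n x * (f - fun x => ∑ j ∈ S, c j * expo j x) x =
        expo n x * f x - ∑ j ∈ S, c j * expo (n + j) x := fun x => by
      simp only [Pi.sub_apply, mul_sub, Finset.mul_sum, expo_add]
      congr 1
      exact Finset.sum_congr rfl fun _ _ => by ring
    have hi : ∀ j ∈ S, Integrable (fun x => c j * expo (n + j) x) freq := fun j _ => by
      simpa [mul_comm] using integrable_expo_mul (integrable_const (c j)) (n + j)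
    have hpi : (2 * Real.pi : ℂ) ≠ 0 := by simp [Real.pi_ne_zero]
    simp only [e]
    rw [integral_sub (integrable_expo_mul hf n) (integrable_finsetSum _ hi),
      integral_finsetSum _ hi]
    simp only [integral_const_mul, integral_expo]
    have hneg : ∀ j : ℤ, n + j = 0 ↔ j = -n := fun j => by omega
    simp only [hneg]
    by_cases hn : -n ∈ S
    · simp only [mul_ite, mul_zero, Finset.sum_ite_eq', hn, if_true, c, neg_neg]
      field_simp
      ring
    · have := h (-n) hn
      rw [neg_neg] at this
      simp [hn, this])
  filter_upwards [key] with x hx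
  simpa [sub_eq_zero] using hx

/-! ### Hilbert space facts -/

/-- Two families with equal Gram matrices are related by an isometry of their closed spans,
given here as an operator on the whole space. -/
theorem exists_operator_of_gram {ι E H : Type*} [NormedAddCommGroup E] [InnerProductSpace ℂ E]
    [CompleteSpace E] [NormedAddCommGroup H] [InnerProductSpace ℂ H] [CompleteSpace H]
    (x : ι → E) (y : ι → H) (hxy : ∀ i j, inner ℂ (x i) (x j) = inner ℂ (y i) (y j)) :
    ∃ Φ : E →L[ℂ] H, (∀ i, Φ (x i) = y i) ∧
      ∀ v ∈ (Submodule.span ℂ (Set.range x)).topologicalClosure, ‖Φ v‖ = ‖v‖ := by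
  set V := (Submodule.span ℂ (Set.range x)).topologicalClosure
  have hmem : ∀ c : ι →₀ ℂ, Finsupp.linearCombination ℂ x c ∈ Submodule.span ℂ (Set.range x) :=
    fun c => by
      rw [← Finsupp.range_linearCombination]; exact LinearMap.mem_range_self _ c
  let e : (ι →₀ ℂ) →ₗ[ℂ] V := (Finsupp.linearCombination ℂ x).codRestrict V
    fun c => Submodule.le_topologicalClosure _ (hmem c)
  let b : (ι →₀ ℂ) →ₗ[ℂ] H := Finsupp.linearCombination ℂ y
  have hnorm : ∀ c, ‖b c‖ = ‖e c‖ := fun c => by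
    have h2 : inner ℂ (b c) (b c) = inner ℂ (e c : E) (e c : E) := by
      simp only [b, e, LinearMap.codRestrict_apply, Finsupp.linearCombination_apply, Finsupp.sum,
        sum_inner, inner_sum, inner_smul_left, inner_smul_right, hxy]
    have h3 : ‖b c‖ ^ 2 = ‖(e c : E)‖ ^ 2 := by
      rw [← inner_self_eq_norm_sq (𝕜 := ℂ), ← inner_self_eq_norm_sq (𝕜 := ℂ), h2]
    simpa using (pow_left_inj₀ (norm_nonneg _) (norm_nonneg _) two_ne_zero).1 h3
  have hdense : DenseRange e := by
    intro v
    rw [Metric.mem_closure_iff]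
    intro ε hε
    obtain ⟨w, hw, hd⟩ := Metric.mem_closure_iff.1 (show (v : E) ∈ closure _ from v.2) ε hε
    rw [SetLike.mem_coe, ← Finsupp.range_linearCombination] at hw
    obtain ⟨c, rfl⟩ := hw
    exact ⟨e c, ⟨c, rfl⟩, hd⟩
  have hb : ∃ C, ∀ c, ‖b c‖ ≤ C * ‖e c‖ := ⟨1, fun c => by rw [hnorm, one_mul]⟩
  let Ψ : V →L[ℂ] H := b.extendOfNorm e
  have hΨ : ∀ c, Ψ (e c) = b c := LinearMap.extendOfNorm_eq hdense hb
  have hV : IsClosed (V : Set E) := Submodule.isClosed_topologicalClosure _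
  have : CompleteSpace V := hV.completeSpace_coe
  have hproj : ∀ v : V, V.orthogonalProjectionOnto (v : E) = v := fun v =>
    Submodule.orthogonalProjectionOnto_mem_subspace_eq_self v
  -- Precomposing with the projection on the closed span makes the operator everywhere defined; off
  -- the span its values are irrelevant.
  refine ⟨Ψ ∘L V.orthogonalProjectionOnto, fun i => ?_, fun v hv => ?_⟩
  · have hx : x i = (e (Finsupp.single i 1) : E) := by simp [e]
    rw [ContinuousLinearMap.comp_apply, hx, hproj, hΨ]
    simp [b]
  · lift v to V using hv
    rw [ContinuousLinearMap.comp_apply, hproj]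
    refine congrFun (hdense.equalizer (g := fun v : V => ‖Ψ v‖) (h := fun v : V => ‖(v : E)‖)
      (by fun_prop) (by fun_prop) ?_) v
    funext c
    simpa [hΨ] using hnorm c

/-- Membership in a closed span, by duality. -/
theorem mem_closure_span_of_inner {E : Type*} [NormedAddCommGroup E] [InnerProductSpace ℂ E]
    [CompleteSpace E] (Q : Set E) (v : E)
    (h : ∀ w : E, (∀ q ∈ Q, inner ℂ q w = 0) → inner ℂ v w = 0) :
    v ∈ (Submodule.span ℂ Q).topologicalClosure := by
  rw [← Submodule.orthogonal_orthogonal_eq_closure, Submodule.mem_orthogonal']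
  intro w hw
  exact h w fun q hq => (Submodule.mem_orthogonal _ _).1 hw q (Submodule.subset_span hq)

/-- An operator that is isometric on a submodule preserves inner products there. -/
theorem inner_map_of_norm_map {E H : Type*} [NormedAddCommGroup E] [InnerProductSpace ℂ E]
    [NormedAddCommGroup H] [InnerProductSpace ℂ H] (Φ : E →L[ℂ] H) (V : Submodule ℂ E)
    (h : ∀ v ∈ V, ‖Φ v‖ = ‖v‖) {u v : E} (hu : u ∈ V) (hv : v ∈ V) :
    inner ℂ (Φ u) (Φ v) = inner ℂ u v := by
  let Ψ : V →ₗᵢ[ℂ] H := ⟨Φ.toLinearMap ∘ₗ V.subtype, fun w => h w w.2⟩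
  exact Ψ.inner_map_map ⟨u, hu⟩ ⟨v, hv⟩

/-! ### Covariances as inner products -/

section Cov

variable {Ω : Type u} [MeasurableSpace Ω] {P : Measure Ω}

/-- The arguments swap because the inner product is conjugate linear in the first variable, while
`cov` conjugates the second. -/
theorem cov_eq_inner (X Y : Lp ℂ 2 P) : cov X Y = inner ℂ Y X := by
  rw [cov, L2.inner_def]
  rfl

theorem meanSqError_eq (X Y : Lp ℂ 2 P) : meanSqError X Y = ‖X - Y‖ ^ 2 := by
  rw [← inner_self_eq_norm_sq (𝕜 := ℂ), L2.inner_def, meanSqError, ← integral_re]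
  · refine integral_congr_ae ?_
    filter_upwards [Lp.coeFn_sub X Y] with ω hω
    rw [inner_self_eq_norm_sq, hω, Pi.sub_apply]
  · exact L2.integrable_inner _ _

/-- Pythagoras: orthogonality of X - Y passes from G to its closed span, so any other estimate Y'
adds ‖Y - Y'‖² to the error. -/
theorem isOptimal_of_inner {G : Set (Lp ℂ 2 P)} {X Y : Lp ℂ 2 P} (hY : Y ∈ closedSpan G)
    (h : ∀ Z ∈ G, inner ℂ Z (X - Y) = 0) : IsOptimalLinearEstimate G X Y := by
  have h' : ∀ Z ∈ closedSpan G, inner ℂ Z (X - Y) = 0 := by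
    have h1 : closedSpan G ≤ LinearMap.ker (innerSL ℂ (X - Y) : Lp ℂ 2 P →ₗ[ℂ] ℂ) := by
      refine Submodule.topologicalClosure_minimal _ ?_ (innerSL ℂ (X - Y)).isClosed_ker
      rw [Submodule.span_le]
      intro Z hZ
      exact inner_eq_zero_symm.1 (h Z hZ)
    intro Z hZ
    exact inner_eq_zero_symm.1 (h1 hZ)
  refine ⟨hY, fun Y' hY' => ?_⟩
  rw [meanSqError_eq, meanSqError_eq]
  have e : X - Y' = (Y - Y') + (X - Y) := by abel
  have := norm_add_sq (𝕜 := ℂ) (Y - Y') (X - Y)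
  rw [h' _ (sub_mem hY hY'), map_zero] at this
  rw [e, this]
  nlinarith [sq_nonneg ‖Y - Y'‖]

end Cov

/-! ### The Hilbert space of a spectral density -/

section Sqrt

open scoped MatrixOrder Matrix.Norms.L2Operator

/-- The function A ↦ √|A| is continuous on all matrices and agrees with the square root on the
positive semidefinite ones. Global continuity is what makes the root of a measurable weight
measurable. -/
theorem exists_continuous_sqrt (T : ℕ) :
    ∃ r : Matrix (Fin T) (Fin T) ℂ → Matrix (Fin T) (Fin T) ℂ, Continuous r ∧
      (∀ A, (r A).IsHermitian) ∧ ∀ A, A.PosSemidef → r A * r A = A := by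
  refine ⟨fun A => CFC.sqrt (CFC.abs A), ?_, fun A => ?_, fun A hA => ?_⟩
  · refine CFC.continuousOn_sqrt.comp_continuous ?_ fun A => CFC.abs_nonneg A
    exact CFC.continuousOn_sqrt.comp_continuous (by fun_prop) fun A => star_mul_self_nonneg A
  · exact (Matrix.nonneg_iff_posSemidef.1 (CFC.sqrt_nonneg (CFC.abs A))).isHermitian
  · have h0 : 0 ≤ A := hA.nonneg
    beta_reduce
    rw [CFC.abs_of_nonneg A h0, CFC.sqrt_mul_sqrt_self A h0]

end Sqrt

/-- A continuous square root on positive semidefinite matrices. -/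
def msqrt {T : ℕ} : Matrix (Fin T) (Fin T) ℂ → Matrix (Fin T) (Fin T) ℂ :=
  (exists_continuous_sqrt T).choose

theorem continuous_msqrt {T : ℕ} : Continuous (msqrt (T := T)) :=
  (exists_continuous_sqrt T).choose_spec.1

theorem isHermitian_msqrt {T : ℕ} (A : Matrix (Fin T) (Fin T) ℂ) : (msqrt A).IsHermitian :=
  (exists_continuous_sqrt T).choose_spec.2.1 A

theorem msqrt_mul_self {T : ℕ} {A : Matrix (Fin T) (Fin T) ℂ} (hA : A.PosSemidef) :
    msqrt A * msqrt A = A :=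
  (exists_continuous_sqrt T).choose_spec.2.2 A hA

/-- Integrable, a.e. positive semidefinite matrix functions. -/
structure IsWeight {T : ℕ} (f : ℝ → Matrix (Fin T) (Fin T) ℂ) : Prop where
  integrable : ∀ ν μ, Integrable (fun x => f x ν μ) freq
  posSemidef : ∀ᵐ x ∂freq, (f x).PosSemidef

theorem IsWeight.add {T : ℕ} {f g : ℝ → Matrix (Fin T) (Fin T) ℂ} (hf : IsWeight f)
    (hg : IsWeight g) : IsWeight (f + g) where
  integrable ν μ := (hf.integrable ν μ).add (hg.integrable ν μ)
  posSemidef := by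
    filter_upwards [hf.posSemidef, hg.posSemidef] with x h1 h2 using h1.add h2

/-- Normalized Lebesgue measure on `(-π, π]`. -/
def nfreq : Measure ℝ := ENNReal.ofReal (2 * Real.pi)⁻¹ • freq

theorem integral_nfreq {E : Type*} [NormedAddCommGroup E] [NormedSpace ℝ E] (F : ℝ → E) :
    ∫ x, F x ∂nfreq = (2 * Real.pi)⁻¹ • ∫ x, F x ∂freq := by
  rw [nfreq, integral_smul_measure, ENNReal.toReal_ofReal (by positivity)]

theorem integral_nfreq_complex (F : ℝ → ℂ) :
    ∫ x, F x ∂nfreq = (2 * Real.pi : ℂ)⁻¹ * ∫ x, F x ∂freq := by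
  rw [integral_nfreq, Complex.real_smul]
  push_cast
  rfl

theorem ofReal_two_pi_inv_ne_zero : ENNReal.ofReal (2 * Real.pi)⁻¹ ≠ 0 := by
  simp [Real.pi_pos]

theorem integrable_nfreq_iff {E : Type*} [NormedAddCommGroup E] {F : ℝ → E} :
    Integrable F nfreq ↔ Integrable F freq :=
  integrable_smul_measure ofReal_two_pi_inv_ne_zero ENNReal.ofReal_ne_top

theorem ae_nfreq_iff {p : ℝ → Prop} : (∀ᵐ x ∂nfreq, p x) ↔ ∀ᵐ x ∂freq, p x := by
  rw [nfreq, Measure.ae_ennreal_smul_measure_iff ofReal_two_pi_inv_ne_zero]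

theorem aestronglyMeasurable_nfreq_iff {E : Type*} [TopologicalSpace E] {F : ℝ → E} :
    AEStronglyMeasurable F nfreq ↔ AEStronglyMeasurable F freq :=
  ⟨fun h => h.mono_ac (Measure.absolutelyContinuous_smul ofReal_two_pi_inv_ne_zero),
    fun h => h.smul_measure _⟩

variable {T : ℕ} {f g : ℝ → Matrix (Fin T) (Fin T) ℂ}

/-- The Hilbert space in which all the spaces `L₂(f)` are realized. -/
abbrev FreqL2 (T : ℕ) : Type := Lp (EuclideanSpace ℂ (Fin T)) 2 nfreq

/-- `hᵀ √f`. -/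
def rootMul (f : ℝ → Matrix (Fin T) (Fin T) ℂ) (h : ℝ → Fin T → ℂ) (x : ℝ) :
    EuclideanSpace ℂ (Fin T) := WithLp.toLp 2 (Matrix.vecMul (h x) (msqrt (f x)))

theorem rootMul_add (h k : ℝ → Fin T → ℂ) : rootMul f (h + k) = rootMul f h + rootMul f k := by
  funext x
  simp [rootMul, Matrix.add_vecMul]

theorem rootMul_smul (c : ℂ) (h : ℝ → Fin T → ℂ) : rootMul f (c • h) = c • rootMul f h := by
  funext x
  simp [rootMul, Matrix.smul_vecMul]

/-- The weighted form at x becomes a Euclidean inner product independent of f, so that Minkowski,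
Cauchy–Schwarz and completeness come from ordinary L². -/
theorem inner_rootMul {x : ℝ} (hx : (f x).PosSemidef) (h k : ℝ → Fin T → ℂ) :
    inner ℂ (rootMul f k x) (rootMul f h x) = h x ⬝ᵥ (f x).mulVec (star (k x)) := by
  rw [rootMul, rootMul, EuclideanSpace.inner_toLp_toLp, Matrix.star_vecMul,
    (isHermitian_msqrt (f x)).eq, ← Matrix.dotProduct_mulVec, Matrix.mulVec_mulVec,
    msqrt_mul_self hx]

theorem quad_eq_norm {x : ℝ} (hx : (f x).PosSemidef) (h : ℝ → Fin T → ℂ) :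
    quad f h x = ((‖rootMul f h x‖ ^ 2 : ℝ) : ℂ) := by
  rw [quad, ← inner_rootMul hx, inner_self_eq_norm_sq_to_K]
  push_cast
  rfl

theorem IsWeight.aestronglyMeasurable (hf : IsWeight f) : AEStronglyMeasurable f freq := by
  have : @AEMeasurable ℝ (Fin T → Fin T → ℂ) _ _ f freq :=
    aemeasurable_pi_lambda _ fun ν => aemeasurable_pi_lambda _ fun μ =>
      (hf.integrable ν μ).aestronglyMeasurable.aemeasurable
  exact this.aestronglyMeasurable

theorem IsWeight.aestronglyMeasurable_rootMul (hf : IsWeight f) {h : ℝ → Fin T → ℂ}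
    (hh : AEStronglyMeasurable h freq) : AEStronglyMeasurable (rootMul f h) nfreq := by
  rw [aestronglyMeasurable_nfreq_iff]
  have h1 := continuous_msqrt.comp_aestronglyMeasurable hf.aestronglyMeasurable
  have h2 : Continuous fun p : (Fin T → ℂ) × Matrix (Fin T) (Fin T) ℂ =>
      (WithLp.toLp 2 (Matrix.vecMul p.1 p.2) : EuclideanSpace ℂ (Fin T)) :=
    (PiLp.continuous_toLp 2 _).comp (continuous_fst.matrix_vecMul continuous_snd)
  exact h2.comp_aestronglyMeasurable (hh.prodMk h1)

theorem IsWeight.memL2_iff (hf : IsWeight f) {h : ℝ → Fin T → ℂ} :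
    MemL2 f h ↔ AEStronglyMeasurable h freq ∧ MemLp (rootMul f h) 2 nfreq := by
  refine and_congr_right fun hh => ?_
  have hm := hf.aestronglyMeasurable_rootMul hh
  rw [memLp_two_iff_integrable_sq_norm hm, integrable_nfreq_iff]
  have : quad f h =ᵐ[freq] fun x => ((‖rootMul f h x‖ ^ 2 : ℝ) : ℂ) := by
    filter_upwards [hf.posSemidef] with x hx using quad_eq_norm hx h
  rw [integrable_congr this]
  exact ⟨fun h => by simpa only [RCLike.re_to_complex, Complex.ofReal_re] using h.re, fun h => h.ofReal⟩

/-- The functions in `L₂(f)`. -/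
def IsWeight.l2 (hf : IsWeight f) : Submodule ℂ (ℝ → Fin T → ℂ) where
  carrier := {h | MemL2 f h}
  zero_mem' := by
    refine ⟨aestronglyMeasurable_const, ?_⟩
    have : quad f 0 = 0 := by funext x; simp [quad]
    rw [this]
    exact integrable_zero _ _ _
  add_mem' {h k} hh hk := by
    have h1 := hf.memL2_iff.1 hh
    have h2 := hf.memL2_iff.1 hk
    exact hf.memL2_iff.2 ⟨h1.1.add h2.1, by rw [rootMul_add]; exact h1.2.add h2.2⟩
  smul_mem' c h hh := by
    have h1 := hf.memL2_iff.1 hh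
    exact hf.memL2_iff.2 ⟨h1.1.const_smul c, by rw [rootMul_smul]; exact h1.2.const_smul c⟩

theorem IsWeight.memLp (hf : IsWeight f) (h : hf.l2) : MemLp (rootMul f h) 2 nfreq :=
  (hf.memL2_iff.1 h.2).2

/-- The isometric embedding of `L₂(f)`. -/
def IsWeight.emb (hf : IsWeight f) : hf.l2 →ₗ[ℂ] FreqL2 T where
  toFun h := (hf.memLp h).toLp _
  map_add' h k := by
    rw [← MemLp.toLp_add]
    exact MemLp.toLp_congr _ _ (by simp [rootMul_add])
  map_smul' c h := by
    rw [RingHom.id_apply, ← MemLp.toLp_const_smul]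
    exact MemLp.toLp_congr _ _ (by simp [rootMul_smul])

theorem IsWeight.coeFn_emb (hf : IsWeight f) (h : hf.l2) :
    ∀ᵐ x ∂freq, hf.emb h x = rootMul f h x := ae_nfreq_iff.1 (hf.memLp h).coeFn_toLp

/-- `(2π)⁻¹ ∫ hᵀ f conj k`. -/
def pairing (f : ℝ → Matrix (Fin T) (Fin T) ℂ) (h k : ℝ → Fin T → ℂ) : ℂ :=
  (2 * Real.pi : ℂ)⁻¹ * ∫ x, h x ⬝ᵥ (f x).mulVec (star (k x)) ∂freq

theorem IsWeight.inner_emb (hf : IsWeight f) (h k : hf.l2) :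
    inner ℂ (hf.emb k) (hf.emb h) = pairing f h k := by
  rw [L2.inner_def, integral_nfreq_complex, pairing]
  congr 1
  refine integral_congr_ae ?_
  filter_upwards [hf.posSemidef, hf.coeFn_emb h, hf.coeFn_emb k] with x hx h1 h2
  rw [h1, h2, inner_rootMul hx]

theorem IsWeight.integrable_pairing (hf : IsWeight f) {h k : ℝ → Fin T → ℂ} (hh : MemL2 f h)
    (hk : MemL2 f k) : Integrable (fun x => h x ⬝ᵥ (f x).mulVec (star (k x))) freq := by
  have := L2.integrable_inner (𝕜 := ℂ) (hf.emb ⟨k, hk⟩) (hf.emb ⟨h, hh⟩)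
  rw [integrable_nfreq_iff] at this
  refine this.congr ?_
  filter_upwards [hf.posSemidef, hf.coeFn_emb ⟨h, hh⟩, hf.coeFn_emb ⟨k, hk⟩] with x hx h1 h2
  rw [h1, h2, inner_rootMul hx]

theorem pairing_self_eq_normSq {h : ℝ → Fin T → ℂ} (hf : IsWeight f) :
    pairing f h h = normSq f h := by
  have hq : ∀ᵐ x ∂freq, h x ⬝ᵥ (f x).mulVec (star (h x)) = ((quad f h x).re : ℂ) := by
    filter_upwards [hf.posSemidef] with x hx
    change quad f h x = _
    rw [quad_eq_norm hx, Complex.ofReal_re]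
  rw [pairing, integral_congr_ae hq, integral_complex_ofReal, normSq]
  push_cast
  rfl

theorem IsWeight.norm_emb_sq (hf : IsWeight f) (h : hf.l2) : ‖hf.emb h‖ ^ 2 = normSq f h := by
  have h1 := hf.inner_emb h h
  rw [pairing_self_eq_normSq hf, inner_self_eq_norm_sq_to_K] at h1
  apply Complex.ofReal_injective
  rw [← h1]
  push_cast
  rfl

/-! ### Bounded functions in L₂(f) and dense families. -/

theorem IsWeight.memL2_of_bounded (hf : IsWeight f) {h : ℝ → Fin T → ℂ}
    (hm : AEStronglyMeasurable h freq) {C : ℝ} (hC : ∀ x ν, ‖h x ν‖ ≤ C) : MemL2 f h := by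
  refine ⟨hm, ?_⟩
  have e : quad f h = fun x => ∑ ν, ∑ μ, h x ν * (f x ν μ * star (h x μ)) := by
    funext x
    simp [quad, dotProduct, Matrix.mulVec, Finset.mul_sum]
  have hmν : ∀ ν, AEStronglyMeasurable (fun x => h x ν) freq := fun ν =>
    (continuous_apply ν).comp_aestronglyMeasurable hm
  rw [e]
  refine integrable_finsetSum _ fun ν _ => integrable_finsetSum _ fun μ _ => ?_
  refine Integrable.bdd_mul (c := C) ?_ (hmν ν) (by filter_upwards with x using hC x ν)
  refine Integrable.mul_bdd (c := C) (hf.integrable ν μ)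
    (continuous_star.comp_aestronglyMeasurable (hmν μ)) ?_
  filter_upwards with x
  rw [norm_star]
  exact hC x μ

theorem IsWeight.memL2_expoVec (hf : IsWeight f) (n : ℤ) (ν : Fin T) :
    MemL2 f (expoVec n ν) := by
  refine hf.memL2_of_bounded (C := 1) ?_ fun x μ => ?_
  · have : Continuous (expoVec n ν) := by
      unfold expoVec
      exact (continuous_single ν).comp (continuous_expo n)
    exact this.aestronglyMeasurable
  · rw [expoVec]
    rcases eq_or_ne μ ν with rfl | h
    · simp [norm_expo]
    · simp [h]

/-- The step function `1_Δ δ_ν`. -/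
def stepVec (Δ : Set ℝ) (ν : Fin T) : ℝ → Fin T → ℂ := Δ.indicator fun _ => Pi.single ν 1

theorem IsWeight.memL2_stepVec (hf : IsWeight f) {Δ : Set ℝ} (hΔ : MeasurableSet Δ) (ν : Fin T) :
    MemL2 f (stepVec Δ ν) := by
  refine hf.memL2_of_bounded (C := 1)
    (stronglyMeasurable_const.indicator hΔ).aestronglyMeasurable fun x μ => ?_
  rw [stepVec]
  by_cases hx : x ∈ Δ
  · rcases eq_or_ne μ ν with rfl | h
    · simp [hx]
    · simp [hx, h]
  · simp [hx]

/-- Take y_ν = ⟨δ_νᵀ√f, w⟩, a product of two L² functions and hence integrable, even where f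
degenerates. Orthogonality to exponentials or step functions thus becomes a statement about Fourier
coefficients or set integrals of L¹ functions. -/
theorem IsWeight.exists_dual (hf : IsWeight f) (w : FreqL2 T) :
    ∃ y : Fin T → ℝ → ℂ, (∀ ν, Integrable (y ν) freq) ∧ ∀ h : hf.l2,
      inner ℂ (hf.emb h) w =
        (2 * Real.pi : ℂ)⁻¹ * ∫ x, ∑ ν, star ((h : ℝ → Fin T → ℂ) x ν) * y ν x ∂freq := by
  have hc : ∀ ν : Fin T, MemL2 f (expoVec 0 ν) := fun ν => hf.memL2_expoVec 0 ν
  refine ⟨fun ν x => inner ℂ (hf.emb ⟨_, hc ν⟩ x) (w x), fun ν => ?_, fun h => ?_⟩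
  · exact integrable_nfreq_iff.1 (L2.integrable_inner (𝕜 := ℂ) (hf.emb ⟨_, hc ν⟩) w)
  · rw [L2.inner_def, integral_nfreq_complex]
    congr 1
    refine integral_congr_ae ?_
    filter_upwards [hf.coeFn_emb h, ae_all_iff.2 fun ν => hf.coeFn_emb ⟨_, hc ν⟩] with x h1 h2
    have e : rootMul f h x = ∑ ν, (h : ℝ → Fin T → ℂ) x ν • rootMul f (expoVec 0 ν) x := by
      simp only [rootMul, ← WithLp.toLp_smul, ← WithLp.toLp_sum, ← Matrix.smul_vecMul,
        ← Matrix.sum_vecMul]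
      congr 2
      funext μ
      simp [expoVec, expo_zero, Pi.single_apply]
    simp only [h1, e, sum_inner, inner_smul_left, h2]
    rfl

theorem IsWeight.emb_mem_closure_expo (hf : IsWeight f) (h : hf.l2) :
    hf.emb h ∈ (Submodule.span ℂ (Set.range fun p : ℤ × Fin T =>
      hf.emb ⟨expoVec p.1 p.2, hf.memL2_expoVec p.1 p.2⟩)).topologicalClosure := by
  refine mem_closure_span_of_inner _ _ fun w hw => ?_
  obtain ⟨y, hy, hyw⟩ := hf.exists_dual w
  have hy0 : ∀ᵐ x ∂freq, ∀ ν, y ν x = 0 := by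
    refine ae_all_iff.2 fun ν => ae_eq_zero_of_fourier (hy ν) fun n => ?_
    -- The inner product conjugates the exponential, so the frequency -n tests the coefficient of y
    -- against e^{inx}.
    have := hw _ ⟨(-n, ν), rfl⟩
    rw [hyw] at this
    simpa [expoVec, Pi.single_apply, apply_ite star, star_expo, Real.pi_ne_zero] using this
  rw [hyw, integral_congr_ae (g := fun _ => 0), integral_zero, mul_zero]
  filter_upwards [hy0] with x hx
  simp [hx]

theorem IsWeight.emb_mem_closure_step (hf : IsWeight f) (h : hf.l2) :
    hf.emb h ∈ (Submodule.span ℂ (Set.range fun p : {Δ : Set ℝ // MeasurableSet Δ} × Fin T =>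
      hf.emb ⟨stepVec p.1 p.2, hf.memL2_stepVec p.1.2 p.2⟩)).topologicalClosure := by
  refine mem_closure_span_of_inner _ _ fun w hw => ?_
  obtain ⟨y, hy, hyw⟩ := hf.exists_dual w
  have hy0 : ∀ᵐ x ∂freq, ∀ ν, y ν x = 0 := by
    refine ae_all_iff.2 fun ν => Integrable.ae_eq_zero_of_forall_setIntegral_eq_zero (hy ν)
      fun Δ hΔ _ => ?_
    have := hw _ ⟨(⟨Δ, hΔ⟩, ν), rfl⟩
    rw [hyw] at this
    have e : ∀ x, ∑ μ, star (stepVec Δ ν x μ) * y μ x = Δ.indicator (y ν) x := fun x => by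
      by_cases hx : x ∈ Δ <;> simp [stepVec, hx, Pi.single_apply, apply_ite star]
    simp only [e, integral_indicator hΔ] at this
    simpa [Real.pi_ne_zero] using this
  rw [hyw, integral_congr_ae (g := fun _ => 0), integral_zero, mul_zero]
  filter_upwards [hy0] with x hx
  simp [hx]

/-- If w is orthogonal to the exponentials with frequency off S, its dual function y is a
trigonometric polynomial with frequencies in S. The pairing of h with y is then a finite combination
of conjugated Fourier coefficients of h on S, all zero. Integrability of h is a separate assumption,
since it does not follow from membership in L₂(f). -/
theorem IsWeight.emb_mem_closure_expo_compl (hf : IsWeight f) (S : Finset ℤ) (h : hf.l2)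
    (hi : ∀ ν, Integrable (fun x => (h : ℝ → Fin T → ℂ) x ν) freq)
    (h0 : ∀ j ∈ S, ∀ ν, ∫ x, expo (-j) x * (h : ℝ → Fin T → ℂ) x ν ∂freq = 0) :
    hf.emb h ∈ (Submodule.span ℂ (Set.range fun p : {j : ℤ // j ∉ S} × Fin T =>
      hf.emb ⟨expoVec p.1 p.2, hf.memL2_expoVec p.1 p.2⟩)).topologicalClosure := by
  refine mem_closure_span_of_inner _ _ fun w hw => ?_
  obtain ⟨y, hy, hyw⟩ := hf.exists_dual w
  have hyS : ∀ ν, ∃ c : ℤ → ℂ, y ν =ᵐ[freq] fun x => ∑ j ∈ S, c j * expo j x := by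
    refine fun ν => ae_eq_trig_of_fourier (hy ν) S fun n hn => ?_
    have := hw _ ⟨(⟨n, hn⟩, ν), rfl⟩
    rw [hyw] at this
    simpa [expoVec, Pi.single_apply, apply_ite star, star_expo, Real.pi_ne_zero] using this
  choose c hc using hyS
  have e : (fun x => ∑ ν, star ((h : ℝ → Fin T → ℂ) x ν) * y ν x) =ᵐ[freq]
      fun x => ∑ ν, ∑ j ∈ S, c ν j * star (expo (-j) x * (h : ℝ → Fin T → ℂ) x ν) := by
    filter_upwards [ae_all_iff.2 hc] with x hx
    refine Finset.sum_congr rfl fun ν _ => ?_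
    rw [hx, Finset.mul_sum]
    refine Finset.sum_congr rfl fun j _ => ?_
    rw [star_mul', star_expo, neg_neg]
    ring
  have hst : ∀ ν, ∀ j : ℤ, Integrable
      (fun x => c ν j * star (expo (-j) x * (h : ℝ → Fin T → ℂ) x ν)) freq := fun ν j =>
    Integrable.const_mul (RCLike.conjCLE.integrable_comp_iff.2
      (integrable_expo_mul (hi ν) (-j))) _
  rw [hyw, integral_congr_ae e, integral_finsetSum _ fun ν _ =>
    integrable_finsetSum _ fun j _ => hst ν j]
  rw [Finset.sum_eq_zero, mul_zero]
  intro ν _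
  rw [integral_finsetSum _ fun j _ => hst ν j]
  refine Finset.sum_eq_zero fun j hj => ?_
  rw [integral_const_mul]
  have : ∫ x, star (expo (-j) x * (h : ℝ → Fin T → ℂ) x ν) ∂freq = 0 := by
    have h2 := integral_conj (μ := freq) (f := fun x => expo (-j) x * (h : ℝ → Fin T → ℂ) x ν)
    rw [h0 j hj ν, map_zero] at h2
    exact h2
  rw [this, mul_zero]

/-! ### The spectral isometry and random measures -/

theorem map_mem_closure_span {E H : Type*} [NormedAddCommGroup E] [InnerProductSpace ℂ E]
    [NormedAddCommGroup H] [InnerProductSpace ℂ H] (Φ : E →L[ℂ] H) {Q : Set E} {R : Set H}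
    (hQ : ∀ q ∈ Q, Φ q ∈ R) {v : E} (hv : v ∈ (Submodule.span ℂ Q).topologicalClosure) :
    Φ v ∈ (Submodule.span ℂ R).topologicalClosure := by
  have hc : IsClosed (((Submodule.span ℂ R).topologicalClosure.comap
      (Φ : E →ₗ[ℂ] H) : Submodule ℂ E) : Set E) :=
    (Submodule.isClosed_topologicalClosure _).preimage Φ.continuous
  refine Submodule.topologicalClosure_minimal _ ?_ hc hv
  rw [Submodule.span_le]
  intro q hq
  exact Submodule.le_topologicalClosure _ (Submodule.subset_span (hQ q hq))

theorem eq_of_mem_closure_span {E H : Type*} [NormedAddCommGroup E] [InnerProductSpace ℂ E]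
    [NormedAddCommGroup H] [NormedSpace ℂ H] (Φ Ψ : E →L[ℂ] H) {Q : Set E}
    (hQ : ∀ q ∈ Q, Φ q = Ψ q) {v : E} (hv : v ∈ (Submodule.span ℂ Q).topologicalClosure) :
    Φ v = Ψ v := by
  have hc : IsClosed ((LinearMap.ker ((Φ - Ψ : E →L[ℂ] H) : E →ₗ[ℂ] H) : Submodule ℂ E) :
    Set E) := (Φ - Ψ).isClosed_ker
  have : v ∈ LinearMap.ker ((Φ - Ψ : E →L[ℂ] H) : E →ₗ[ℂ] H) := by
    refine Submodule.topologicalClosure_minimal _ ?_ hc hv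
    rw [Submodule.span_le]
    intro q hq
    simp [hQ q hq]
  simpa [sub_eq_zero] using this

theorem inner_eq_zero_of_mem_closure_span {E : Type*} [NormedAddCommGroup E]
    [InnerProductSpace ℂ E] {Q : Set E} {w v : E} (hQ : ∀ q ∈ Q, inner ℂ w q = 0)
    (hv : v ∈ (Submodule.span ℂ Q).topologicalClosure) : inner ℂ w v = 0 := by
  have := eq_of_mem_closure_span (innerSL ℂ w) 0 (Q := Q) (by simpa using hQ) hv
  simpa using this

theorem inner_eq_zero_of_mem_closure_span₂ {E : Type*} [NormedAddCommGroup E]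
    [InnerProductSpace ℂ E] {Q R : Set E} {w v : E} (h : ∀ r ∈ R, ∀ q ∈ Q, inner ℂ r q = 0)
    (hw : w ∈ (Submodule.span ℂ R).topologicalClosure)
    (hv : v ∈ (Submodule.span ℂ Q).topologicalClosure) : inner ℂ w v = 0 := by
  refine inner_eq_zero_of_mem_closure_span (fun q hq => ?_) hv
  exact inner_eq_zero_symm.1 (inner_eq_zero_of_mem_closure_span
    (fun r hr => inner_eq_zero_symm.1 (h r hr q hq)) hw)

section

variable {Ω : Type u} [MeasurableSpace Ω] {P : Measure Ω} {T : ℕ}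
  {f g : ℝ → Matrix (Fin T) (Fin T) ℂ} {ξ η : ℤ → Fin T → Lp ℂ 2 P}

theorem HasSpectralDensity.isWeight (h : HasSpectralDensity ξ f) : IsWeight f :=
  ⟨h.integrable, h.posSemidef⟩

theorem expoVec_pairing (n m : ℤ) (ν μ : Fin T) (x : ℝ) :
    expoVec n ν x ⬝ᵥ (f x).mulVec (star (expoVec m μ x)) = expo (n - m) x * f x ν μ := by
  have : star (expoVec m μ x) = Pi.single μ (star (expo m x)) := by
    rw [expoVec, Pi.single_star]
  rw [this, expoVec, single_dotProduct, Matrix.mulVec_single, star_expo, sub_eq_add_neg, expo_add]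
  simp
  ring

theorem pairing_expoVec (n m : ℤ) (ν μ : Fin T) : pairing f (expoVec n ν) (expoVec m μ) =
    (2 * Real.pi : ℂ)⁻¹ * ∫ x, expo (n - m) x * f x ν μ ∂freq := by
  simp only [pairing, expoVec_pairing]

theorem pairing_stepVec {Δ₁ Δ₂ : Set ℝ} (h₁ : MeasurableSet Δ₁) (h₂ : MeasurableSet Δ₂)
    (ν μ : Fin T) : pairing f (stepVec Δ₁ ν) (stepVec Δ₂ μ) =
      (2 * Real.pi : ℂ)⁻¹ * ∫ x in Δ₁ ∩ Δ₂, f x ν μ ∂freq := by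
  rw [pairing, ← integral_indicator (h₁.inter h₂)]
  congr 2
  funext x
  have : star (stepVec Δ₂ μ x) = stepVec Δ₂ μ x := by
    by_cases hx : x ∈ Δ₂
    · simp [stepVec, hx]
    · simp [stepVec, hx]
  rw [this]
  by_cases h1 : x ∈ Δ₁ <;> by_cases h2 : x ∈ Δ₂ <;> simp [stepVec, h1, h2]

/-- `Φ` restricts to the isometry `L₂(f) → L²(P)` that maps `exp (i n x) δ_ν` to `ξ_ν(n)`. -/
structure IsSpectralIso (hf : IsWeight f) (ξ : ℤ → Fin T → Lp ℂ 2 P)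
    (Φ : FreqL2 T →L[ℂ] Lp ℂ 2 P) : Prop where
  map_expo : ∀ n ν, Φ (hf.emb ⟨expoVec n ν, hf.memL2_expoVec n ν⟩) = ξ n ν
  norm_map : ∀ h : hf.l2, ‖Φ (hf.emb h)‖ = ‖hf.emb h‖

theorem IsSpectralIso.inner_map {hf : IsWeight f} {Φ : FreqL2 T →L[ℂ] Lp ℂ 2 P}
    (hΦ : IsSpectralIso hf ξ Φ) (h k : hf.l2) :
    inner ℂ (Φ (hf.emb k)) (Φ (hf.emb h)) = pairing f h k := by
  rw [← hf.inner_emb]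
  refine inner_map_of_norm_map Φ (LinearMap.range hf.emb) ?_ (LinearMap.mem_range_self _ _)
    (LinearMap.mem_range_self _ _)
  rintro _ ⟨u, rfl⟩
  exact hΦ.norm_map u

/-- Kolmogorov's isomorphism: the definition of the spectral density says that the exponentials and
the values of ξ have equal Gram matrices. -/
theorem HasSpectralDensity.exists_iso (h : HasSpectralDensity ξ f) :
    ∃ Φ, IsSpectralIso h.isWeight ξ Φ := by
  set hf := h.isWeight
  obtain ⟨Φ, h1, h2⟩ := exists_operator_of_gram
    (fun p : ℤ × Fin T => hf.emb ⟨expoVec p.1 p.2, hf.memL2_expoVec p.1 p.2⟩)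
    (fun p : ℤ × Fin T => ξ p.1 p.2) (fun p q => by
      rw [hf.inner_emb, pairing_expoVec, ← h.cov_eq, cov_eq_inner])
  exact ⟨Φ, fun n ν => h1 (n, ν), fun u => h2 _ (hf.emb_mem_closure_expo u)⟩

theorem IsSpectralIso.mem_closedSpan {hf : IsWeight f} {Φ : FreqL2 T →L[ℂ] Lp ℂ 2 P}
    (hΦ : IsSpectralIso hf ξ Φ) (h : hf.l2) :
    Φ (hf.emb h) ∈ closedSpan (Set.range fun p : ℤ × Fin T => ξ p.1 p.2) := by
  refine map_mem_closure_span Φ ?_ (hf.emb_mem_closure_expo h)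
  rintro _ ⟨p, rfl⟩
  exact ⟨p, (hΦ.map_expo p.1 p.2).symm⟩

theorem IsSpectralIso.unique {hf : IsWeight f} {Φ Ψ : FreqL2 T →L[ℂ] Lp ℂ 2 P}
    (hΦ : IsSpectralIso hf ξ Φ) (hΨ : IsSpectralIso hf ξ Ψ) (h : hf.l2) :
    Φ (hf.emb h) = Ψ (hf.emb h) := by
  refine eq_of_mem_closure_span Φ Ψ ?_ (hf.emb_mem_closure_expo h)
  rintro _ ⟨p, rfl⟩
  rw [hΦ.map_expo, hΨ.map_expo]

/-- A vector with the right norm and the right inner products is the image under the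
isometry. -/
theorem IsSpectralIso.eq_of_inner {hf : IsWeight f} {Φ : FreqL2 T →L[ℂ] Lp ℂ 2 P}
    (hΦ : IsSpectralIso hf ξ Φ) (u : hf.l2) (W : Lp ℂ 2 P)
    (hW : ∀ n ν, inner ℂ W (ξ n ν) = pairing f (expoVec n ν) u)
    (hn : ‖W‖ = ‖hf.emb u‖) : W = Φ (hf.emb u) := by
  have h0 : ∀ n ν, inner ℂ W (Φ (hf.emb ⟨expoVec n ν, hf.memL2_expoVec n ν⟩)) =
      inner ℂ (hf.emb u) (hf.emb ⟨expoVec n ν, hf.memL2_expoVec n ν⟩) := fun n ν => by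
    rw [hΦ.map_expo, hW, hf.inner_emb]
  have h1 : inner ℂ W (Φ (hf.emb u)) = inner ℂ (hf.emb u) (hf.emb u) := by
    refine eq_of_mem_closure_span ((innerSL ℂ W).comp Φ) (innerSL ℂ (hf.emb u)) ?_
      (hf.emb_mem_closure_expo u)
    rintro _ ⟨p, rfl⟩
    exact h0 p.1 p.2
  -- With ⟨W, Φu⟩ = ‖u‖² and equal norms, the expansion of ‖W - Φu‖² collapses to 0; it is not
  -- needed beforehand that W lies in the range.
  have h2 := norm_sub_sq (𝕜 := ℂ) W (Φ (hf.emb u))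
  rw [h1, inner_self_eq_norm_sq, hΦ.norm_map, hn] at h2
  rw [← sub_eq_zero, ← norm_eq_zero]
  have : ‖W - Φ (hf.emb u)‖ ^ 2 = 0 := by rw [h2]; ring
  simpa using this

theorem sum_single_smul {E : Type*} [AddCommGroup E] [Module ℂ E] (ν : Fin T) (c : ℂ)
    (F : Fin T → E) : ∑ μ, (Pi.single ν c : Fin T → ℂ) μ • F μ = c • F ν := by
  simp [Pi.single_apply]

theorem step_sum_eq (m : ℕ) (Δ : Fin m → Set ℝ) (v : Fin m → Fin T → ℂ) :
    (fun x => ∑ i, (Δ i).indicator (fun _ => v i) x) =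
      ∑ i, ∑ ν, v i ν • stepVec (Δ i) ν := by
  funext x
  rw [Finset.sum_apply]
  refine Finset.sum_congr rfl fun i _ => ?_
  rw [Finset.sum_apply]
  by_cases hx : x ∈ Δ i
  · funext μ
    simp [stepVec, hx, Pi.single_apply]
  · simp [stepVec, hx]

theorem IsWeight.normSq_sub (hf : IsWeight f) (h k : hf.l2) :
    normSq f (h - k : ℝ → Fin T → ℂ) = ‖hf.emb h - hf.emb k‖ ^ 2 := by
  rw [← map_sub, hf.norm_emb_sq]
  rfl

/-- The isometry is a stochastic integral with respect to the measure it induces. -/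
theorem IsSpectralIso.isStochIntegral {hf : IsWeight f} {Φ : FreqL2 T →L[ℂ] Lp ℂ 2 P}
    (hΦ : IsSpectralIso hf ξ Φ) {Z : Set ℝ → Fin T → Lp ℂ 2 P}
    (hZ : ∀ (Δ : Set ℝ) (hΔ : MeasurableSet Δ) ν,
      Z Δ ν = Φ (hf.emb ⟨stepVec Δ ν, hf.memL2_stepVec hΔ ν⟩)) (h : hf.l2) :
    IsStochIntegral f Z h (Φ (hf.emb h)) := by
  refine ⟨h.2, fun ε hε => ?_⟩
  obtain ⟨p, hp, hd⟩ := Metric.mem_closure_iff.1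
    (show hf.emb h ∈ closure _ from hf.emb_mem_closure_step h) (Real.sqrt ε) (Real.sqrt_pos.2 hε)
  obtain ⟨m, c, q, rfl⟩ := Submodule.mem_span_set'.1 hp
  choose p hp' using fun i => (q i).2
  have hmem : ∀ i : Fin m, ∀ ν : Fin T, stepVec ((p i).1 : Set ℝ) ν ∈ hf.l2 :=
    fun i ν => hf.memL2_stepVec (p i).1.2 ν
  let u : hf.l2 := ∑ i, c i • ⟨stepVec (p i).1 (p i).2, hmem i (p i).2⟩
  have hu : hf.emb u = ∑ i, c i • (q i : FreqL2 T) := by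
    simp only [u, map_sum, map_smul]
    exact Finset.sum_congr rfl fun i _ => by rw [← hp' i]
  have hsmall : ‖hf.emb h - hf.emb u‖ ^ 2 < ε := by
    rw [hu, ← dist_eq_norm]
    exact (Real.lt_sqrt dist_nonneg).1 hd
  refine ⟨m, fun i => (p i).1, fun i => Pi.single (p i).2 (c i), fun i => (p i).1.2, ?_, ?_⟩
  · rw [step_sum_eq]
    simp only [sum_single_smul]
    have : (∑ i, c i • stepVec ((p i).1 : Set ℝ) (p i).2) = (u : ℝ → Fin T → ℂ) := by
      simp [u]
    rw [this, hf.normSq_sub]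
    exact hsmall
  · simp only [sum_single_smul]
    have : ∑ i, c i • Z (p i).1 (p i).2 = Φ (hf.emb u) := by
      simp only [u, map_sum, map_smul, hZ _ (p _).1.2]
    rw [this, meanSqError_eq, ← map_sub, ← map_sub, hΦ.norm_map, map_sub]
    exact hsmall

/-- The mean is the inner product with the constant 1, which is in L² of a probability space, so
vanishing passes to closed spans. -/
theorem mean_eq_zero_of_mem_closedSpan [IsProbabilityMeasure P] {G : Set (Lp ℂ 2 P)}
    (hG : ∀ X ∈ G, mean X = 0) {X : Lp ℂ 2 P} (hX : X ∈ closedSpan G) : mean X = 0 := by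
  have e : ∀ X : Lp ℂ 2 P, mean X = inner ℂ (Lp.const 2 P (1 : ℂ)) X := fun X => by
    rw [mean, L2.inner_def]
    refine integral_congr_ae ?_
    filter_upwards [Lp.coeFn_const (p := 2) (μ := P) (1 : ℂ)] with ω hω
    rw [hω]
    simp
  rw [e]
  exact inner_eq_zero_of_mem_closure_span (fun q hq => by rw [← e, hG q hq]) hX

theorem IsSpectralIso.exists_measure [IsProbabilityMeasure P] {hf : IsWeight f}
    {Φ : FreqL2 T →L[ℂ] Lp ℂ 2 P} (hΦ : IsSpectralIso hf ξ Φ) (hξ : IsStationary ξ) :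
    ∃ Z, IsSpectralRandomMeasure ξ f Z := by
  classical
  -- Every condition on a random measure concerns measurable sets only, so the value 0 elsewhere is
  -- harmless.
  let Z : Set ℝ → Fin T → Lp ℂ 2 P := fun Δ ν =>
    if hΔ : MeasurableSet Δ then Φ (hf.emb ⟨stepVec Δ ν, hf.memL2_stepVec hΔ ν⟩) else 0
  have hZ : ∀ (Δ : Set ℝ) (hΔ : MeasurableSet Δ) ν,
      Z Δ ν = Φ (hf.emb ⟨stepVec Δ ν, hf.memL2_stepVec hΔ ν⟩) := fun Δ hΔ ν => dif_pos hΔ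
  refine ⟨Z, fun Δ hΔ ν => ?_, fun Δ₁ Δ₂ h₁ h₂ hd => ?_, fun Δ₁ Δ₂ h₁ h₂ ν μ => ?_, fun n ν => ?_⟩
  · rw [hZ Δ hΔ]
    refine mean_eq_zero_of_mem_closedSpan ?_ (hΦ.mem_closedSpan _)
    rintro _ ⟨p, rfl⟩
    exact hξ.mean_zero _ _
  · funext ν
    rw [Pi.add_apply, hZ _ h₁, hZ _ h₂, hZ _ (h₁.union h₂), ← map_add, ← map_add]
    congr 2
    exact Subtype.ext (Set.indicator_union_of_disjoint hd _)
  · rw [hZ _ h₁, hZ _ h₂, cov_eq_inner, hΦ.inner_map, pairing_stepVec h₁ h₂]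
  · rw [← hΦ.map_expo]
    exact hΦ.isStochIntegral hZ ⟨expoVec n ν, hf.memL2_expoVec n ν⟩

/-- Every orthogonal random measure of `ξ` is induced by the spectral isometry. -/
theorem IsSpectralRandomMeasure.eq_iso {hf : IsWeight f} {Φ : FreqL2 T →L[ℂ] Lp ℂ 2 P}
    (hΦ : IsSpectralIso hf ξ Φ) {Z : Set ℝ → Fin T → Lp ℂ 2 P}
    (hZ : IsSpectralRandomMeasure ξ f Z) (Δ : Set ℝ) (hΔ : MeasurableSet Δ) (ν : Fin T) :
    Z Δ ν = Φ (hf.emb ⟨stepVec Δ ν, hf.memL2_stepVec hΔ ν⟩) := by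
  -- By `cov_eq` the values of Z have the Gram matrix of the step functions, so Z induces an
  -- isometry Ψ of its own. The representation of ξ forces the values of Ψ on exponentials, and
  -- these determine it on L₂(f).
  obtain ⟨Ψ, h1, h2⟩ := exists_operator_of_gram
    (fun p : {Δ : Set ℝ // MeasurableSet Δ} × Fin T =>
      hf.emb ⟨stepVec p.1 p.2, hf.memL2_stepVec p.1.2 p.2⟩)
    (fun p => Z p.1 p.2) (fun p q => by
      rw [hf.inner_emb, pairing_stepVec q.1.2 p.1.2, ← hZ.cov_eq _ _ q.1.2 p.1.2, cov_eq_inner])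
  have hn : ∀ h : hf.l2, ‖Ψ (hf.emb h)‖ = ‖hf.emb h‖ := fun h =>
    h2 _ (hf.emb_mem_closure_step h)
  have hΨ : IsSpectralIso hf ξ Ψ := by
    refine ⟨fun n μ => ?_, hn⟩
    refine eq_of_forall_dist_le fun ε hε => ?_
    -- Both approximation bounds are on squared norms, hence (ε / 2)²; the triangle inequality adds
    -- the two halves.
    obtain ⟨m, Δ', v, hΔ', hd1, hd2⟩ := (hZ.repr n μ).2 ((ε / 2) ^ 2) (by positivity)
    let s : hf.l2 := ∑ i, ∑ κ, v i κ • ⟨stepVec (Δ' i) κ, hf.memL2_stepVec (hΔ' i) κ⟩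
    have hs : (s : ℝ → Fin T → ℂ) = ∑ i, ∑ κ, v i κ • stepVec (Δ' i) κ := by simp [s]
    have hs' : Ψ (hf.emb s) = ∑ i, ∑ κ, v i κ • Z (Δ' i) κ := by
      simp only [s, map_sum, map_smul]
      refine Finset.sum_congr rfl fun i _ => Finset.sum_congr rfl fun κ _ => ?_
      rw [h1 (⟨Δ' i, hΔ' i⟩, κ)]
    rw [step_sum_eq, ← hs, hf.normSq_sub ⟨expoVec n μ, hf.memL2_expoVec n μ⟩] at hd1
    rw [← hs', meanSqError_eq] at hd2
    have e1 := abs_lt_of_sq_lt_sq hd1 (by positivity)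
    have e2 := abs_lt_of_sq_lt_sq hd2 (by positivity)
    rw [abs_norm] at e1 e2
    rw [← map_sub, ← hn, map_sub, map_sub, ← dist_eq_norm] at e1
    rw [← dist_eq_norm, dist_comm] at e2
    linarith [dist_triangle (Ψ (hf.emb ⟨expoVec n μ, hf.memL2_expoVec n μ⟩)) (Ψ (hf.emb s))
      (ξ n μ)]
  rw [hΦ.unique hΨ, h1 (⟨Δ, hΔ⟩, ν)]

theorem HasSpectralDensity.add (hξ : HasSpectralDensity ξ f) (hη : HasSpectralDensity η g)
    (h : ∀ n m ν μ, cov (ξ n ν) (η m μ) = 0) : HasSpectralDensity (ξ + η) (f + g) := by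
  have hw := hξ.isWeight.add hη.isWeight
  refine ⟨hw.integrable, hw.posSemidef, fun n m ν μ => ?_⟩
  have h' : cov (η n ν) (ξ m μ) = 0 := by
    have := h m n μ ν
    rw [cov_eq_inner] at this ⊢
    exact inner_eq_zero_symm.1 this
  have e : ∫ x, expo (n - m) x * (f + g) x ν μ ∂freq =
      ∫ x, expo (n - m) x * f x ν μ ∂freq + ∫ x, expo (n - m) x * g x ν μ ∂freq := by
    rw [← integral_add (integrable_expo_mul (hξ.integrable ν μ) _)
      (integrable_expo_mul (hη.integrable ν μ) _)]
    simp [mul_add]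
  have h1 := hξ.cov_eq n m ν μ
  have h2 := hη.cov_eq n m ν μ
  have h3 := h n m ν μ
  rw [cov_eq_inner] at h1 h2 h3 h' ⊢
  rw [e, mul_add, ← h1, ← h2]
  simp only [Pi.add_apply, inner_add_left, inner_add_right, h3, h']
  ring

theorem pairing_add {h k : ℝ → Fin T → ℂ} (hf : IsWeight f) (hg : IsWeight g)
    (h1 : MemL2 f h) (k1 : MemL2 f k) (h2 : MemL2 g h) (k2 : MemL2 g k) :
    pairing (f + g) h k = pairing f h k + pairing g h k := by
  rw [pairing, pairing, pairing, ← mul_add, ← integral_add (hf.integrable_pairing h1 k1)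
    (hg.integrable_pairing h2 k2)]
  simp [Matrix.add_mulVec]

/-- The isometry of a sum of uncorrelated sequences is the sum of the isometries. -/
theorem IsSpectralIso.add {hf : IsWeight f} {hg : IsWeight g}
    {Φ Ψ Θ : FreqL2 T →L[ℂ] Lp ℂ 2 P} (hΦ : IsSpectralIso hf ξ Φ) (hΨ : IsSpectralIso hg η Ψ)
    (hΘ : IsSpectralIso (hf.add hg) (ξ + η) Θ) (h : ∀ n m ν μ, cov (ξ n ν) (η m μ) = 0)
    {u : ℝ → Fin T → ℂ} (u1 : MemL2 f u) (u2 : MemL2 g u) (u3 : MemL2 (f + g) u) :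
    Φ (hf.emb ⟨u, u1⟩) + Ψ (hg.emb ⟨u, u2⟩) = Θ ((hf.add hg).emb ⟨u, u3⟩) := by
  have ho : ∀ (v : hf.l2) (w : hg.l2), inner ℂ (Φ (hf.emb v)) (Ψ (hg.emb w)) = 0 := by
    intro v w
    refine inner_eq_zero_of_mem_closure_span₂ ?_ (hΦ.mem_closedSpan v) (hΨ.mem_closedSpan w)
    rintro _ ⟨p, rfl⟩ _ ⟨q, rfl⟩
    rw [inner_eq_zero_symm, ← cov_eq_inner]
    exact h _ _ _ _
  have key : ∀ (v : ℝ → Fin T → ℂ) (v1 : MemL2 f v) (v2 : MemL2 g v),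
      inner ℂ (Φ (hf.emb ⟨u, u1⟩) + Ψ (hg.emb ⟨u, u2⟩))
        (Φ (hf.emb ⟨v, v1⟩) + Ψ (hg.emb ⟨v, v2⟩)) = pairing (f + g) v u := by
    intro v v1 v2
    rw [inner_add_left, inner_add_right, inner_add_right, ho, hΦ.inner_map ⟨v, v1⟩,
      hΨ.inner_map ⟨v, v2⟩, inner_eq_zero_symm.1 (ho ⟨v, v1⟩ ⟨u, u2⟩),
      pairing_add hf hg v1 u1 v2 u2]
    ring
  -- The cross terms vanish, so the left side has the norm of u in L₂(f + g) and the right inner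
  -- products with ξ + η; this identifies it.
  refine hΘ.eq_of_inner ⟨u, u3⟩ _ (fun n ν => ?_) ?_
  · rw [← key _ (hf.memL2_expoVec n ν) (hg.memL2_expoVec n ν), hΦ.map_expo, hΨ.map_expo]
    rfl
  · have := key u u1 u2
    rw [← (hf.add hg).inner_emb ⟨u, u3⟩ ⟨u, u3⟩, inner_self_eq_norm_sq_to_K,
      inner_self_eq_norm_sq_to_K] at this
    exact (pow_left_inj₀ (norm_nonneg _) (norm_nonneg _) two_ne_zero).1 (by exact_mod_cast this)

end

/-! ### Positive semidefinite matrices -/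

section Matrices

open Matrix

variable {T : ℕ} {A B : Matrix (Fin T) (Fin T) ℂ}

/-- Cauchy–Schwarz for √A u and √A v, followed by xy ≤ x² + y². The constant is not sharp, but only
integrability depends on it. -/
theorem norm_dotProduct_mulVec_le (hA : A.PosSemidef) (u v : Fin T → ℂ) :
    ‖star u ⬝ᵥ A *ᵥ v‖ ≤ (star u ⬝ᵥ A *ᵥ u).re + (star v ⬝ᵥ A *ᵥ v).re := by
  have e : ∀ u v : Fin T → ℂ, star u ⬝ᵥ A *ᵥ v = inner ℂ
      (WithLp.toLp 2 (msqrt A *ᵥ u) : EuclideanSpace ℂ (Fin T)) (WithLp.toLp 2 (msqrt A *ᵥ v)) := by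
    intro u v
    rw [EuclideanSpace.inner_toLp_toLp, star_mulVec, (isHermitian_msqrt A).eq,
      dotProduct_comm (msqrt A *ᵥ v), ← dotProduct_mulVec, mulVec_mulVec, msqrt_mul_self hA]
  rw [e u v, e u u, e v v]
  simp only [← RCLike.re_to_complex, inner_self_eq_norm_sq]
  refine (norm_inner_le_norm _ _).trans ?_
  nlinarith [sq_nonneg (‖(WithLp.toLp 2 (msqrt A *ᵥ u) : EuclideanSpace ℂ (Fin T))‖ -
    ‖(WithLp.toLp 2 (msqrt A *ᵥ v) : EuclideanSpace ℂ (Fin T))‖),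
    norm_nonneg (WithLp.toLp 2 (msqrt A *ᵥ u) : EuclideanSpace ℂ (Fin T)),
    norm_nonneg (WithLp.toLp 2 (msqrt A *ᵥ v) : EuclideanSpace ℂ (Fin T))]

theorem diag_re_le_trace (hA : A.PosSemidef) (i : Fin T) : (A i i).re ≤ A.trace.re := by
  rw [trace, Complex.re_sum]
  exact Finset.single_le_sum (f := fun i => (A.diag i).re)
    (fun j _ => (Complex.le_def.1 hA.diag_nonneg).1) (Finset.mem_univ i)

theorem entry_eq (A : Matrix (Fin T) (Fin T) ℂ) (i j : Fin T) :
    A i j = star (Pi.single i 1 : Fin T → ℂ) ⬝ᵥ A *ᵥ Pi.single j 1 := by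
  rw [← Pi.single_star, star_one, single_one_dotProduct, mulVec_single_one]
  rfl

theorem norm_entry_le (hA : A.PosSemidef) (i j : Fin T) : ‖A i j‖ ≤ 2 * A.trace.re := by
  have := norm_dotProduct_mulVec_le hA (Pi.single i 1) (Pi.single j 1)
  rw [← entry_eq, ← entry_eq, ← entry_eq] at this
  linarith [diag_re_le_trace hA i, diag_re_le_trace hA j]

theorem mul_inv_mul_eq_sub (hU : IsUnit (A + B)) :
    A * (A + B)⁻¹ * B = A - A * (A + B)⁻¹ * A := by
  have h : A * (A + B)⁻¹ * (A + B) = A := by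
    rw [mul_assoc, nonsing_inv_mul _ ((isUnit_iff_isUnit_det _).1 hU), mul_one]
  rw [eq_sub_iff_add_eq, ← mul_add, add_comm B A, h]

/-- With M = (A + B)⁻¹A the parallel sum equals (1 - M)ᴴA(1 - M) + MᴴBM, a sum of congruences of A
and B. Neither A nor B has to be invertible. -/
theorem posSemidef_mul_inv_mul (hA : A.PosSemidef) (hB : B.PosSemidef) (hU : IsUnit (A + B)) :
    (A * (A + B)⁻¹ * B).PosSemidef := by
  have hM : ((A + B)⁻¹)ᴴ = (A + B)⁻¹ := (hA.add hB).inv.isHermitian.eq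
  have hd := (isUnit_iff_isUnit_det _).1 hU
  have h1 : (A + B)⁻¹ * (A + B) = 1 := nonsing_inv_mul _ hd
  have e : A * (A + B)⁻¹ * B = (1 - (A + B)⁻¹ * A)ᴴ * A * (1 - (A + B)⁻¹ * A) +
      ((A + B)⁻¹ * A)ᴴ * B * ((A + B)⁻¹ * A) := by
    rw [mul_inv_mul_eq_sub hU]
    simp only [conjTranspose_sub, conjTranspose_one, conjTranspose_mul, hM, hA.isHermitian.eq]
    have h2 : A * (A + B)⁻¹ * A = A * (A + B)⁻¹ * A * ((A + B)⁻¹ * A) +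
        A * (A + B)⁻¹ * B * ((A + B)⁻¹ * A) := by
      have h4 : A * (A + B)⁻¹ * (A + B) = A := by rw [mul_assoc, h1, mul_one]
      rw [← add_mul, ← mul_add, h4, mul_assoc]
    have h3 : (1 - A * (A + B)⁻¹) * A * (1 - (A + B)⁻¹ * A) = A - A * (A + B)⁻¹ * A -
        A * (A + B)⁻¹ * A + A * (A + B)⁻¹ * A * ((A + B)⁻¹ * A) := by noncomm_ring
    rw [h3]
    nth_rewrite 3 [h2]
    abel
  rw [e]
  exact (hA.conjTranspose_mul_mul_same _).add (hB.conjTranspose_mul_mul_same _)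

/-- The parallel sum is A minus the positive semidefinite matrix A(A + B)⁻¹A, so its trace is at
most that of A. -/
theorem norm_mul_inv_mul_entry_le (hA : A.PosSemidef) (hB : B.PosSemidef) (hU : IsUnit (A + B))
    (i j : Fin T) : ‖(A * (A + B)⁻¹ * B) i j‖ ≤ 2 * A.trace.re := by
  have h := norm_entry_le (posSemidef_mul_inv_mul hA hB hU) i j
  have h2 : 0 ≤ (A * (A + B)⁻¹ * A).trace := by
    have := (hA.add hB).inv.conjTranspose_mul_mul_same A
    rw [hA.isHermitian.eq] at this
    exact this.trace_nonneg
  rw [mul_inv_mul_eq_sub hU] at h ⊢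
  rw [trace_sub, Complex.sub_re] at h
  linarith [(Complex.le_def.1 h2).1, Complex.zero_re]

/-- Apply the form bound for A to e_i and (A + B)⁻¹e_j. The second term is a diagonal entry of (A +
B)⁻¹A(A + B)⁻¹, which is dominated by (A + B)⁻¹ because adding the same expression in B gives
exactly (A + B)⁻¹. -/
theorem norm_mul_inv_entry_le (hA : A.PosSemidef) (hB : B.PosSemidef) (hU : IsUnit (A + B))
    (i j : Fin T) : ‖(A * (A + B)⁻¹) i j‖ ≤ A.trace.re + ((A + B)⁻¹).trace.re := by
  have hM := (hA.add hB).inv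
  have hd := (isUnit_iff_isUnit_det _).1 hU
  have h := norm_dotProduct_mulVec_le hA (Pi.single i 1) ((A + B)⁻¹ *ᵥ Pi.single j 1)
  rw [mulVec_mulVec, ← entry_eq, ← entry_eq, star_mulVec, hM.isHermitian.eq,
    ← dotProduct_mulVec, mulVec_mulVec, ← entry_eq] at h
  have h1 : (A + B)⁻¹ * (A * (A + B)⁻¹) + (A + B)⁻¹ * B * (A + B)⁻¹ = (A + B)⁻¹ := by
    rw [← mul_assoc, ← add_mul, ← mul_add, nonsing_inv_mul _ hd, one_mul]
  have h2 := hB.conjTranspose_mul_mul_same (A + B)⁻¹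
  rw [hM.isHermitian.eq] at h2
  have h3 := (Complex.le_def.1 (h2.diag_nonneg (i := j))).1
  have h4 := congrArg (fun M : Matrix (Fin T) (Fin T) ℂ => (M j j).re) h1
  simp only [Matrix.add_apply, Complex.add_re, Complex.zero_re] at h3 h4
  simp only [← mul_assoc] at h h4
  linarith [diag_re_le_trace hA i, diag_re_le_trace hM j]

end Matrices

/-! ### Integrability and the block matrices -/

section Blocks

variable {T : ℕ} {f g : ℝ → Matrix (Fin T) (Fin T) ℂ}

theorem aestronglyMeasurable_entry {μ : Measure ℝ} {K : ℝ → Matrix (Fin T) (Fin T) ℂ}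
    (hK : AEStronglyMeasurable K μ) (i j : Fin T) :
    AEStronglyMeasurable (fun x => K x i j) μ :=
  (continuous_id.matrix_elem i j).comp_aestronglyMeasurable hK

theorem aestronglyMeasurable_matrix_mul {μ : Measure ℝ} {K L : ℝ → Matrix (Fin T) (Fin T) ℂ}
    (hK : AEStronglyMeasurable K μ) (hL : AEStronglyMeasurable L μ) :
    AEStronglyMeasurable (fun x => K x * L x) μ :=
  (continuous_fst.matrix_mul continuous_snd).comp_aestronglyMeasurable (hK.prodMk hL)

theorem aestronglyMeasurable_matrix_inv {μ : Measure ℝ} {K : ℝ → Matrix (Fin T) (Fin T) ℂ}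
    (hK : AEStronglyMeasurable K μ) : AEStronglyMeasurable (fun x => (K x)⁻¹) μ := by
  have h1 : AEStronglyMeasurable (fun x => (K x).det) μ :=
    continuous_id.matrix_det.comp_aestronglyMeasurable hK
  have h2 : AEStronglyMeasurable (fun x => (K x).adjugate) μ :=
    continuous_id.matrix_adjugate.comp_aestronglyMeasurable hK
  have h3 : AEStronglyMeasurable (fun x => ((K x).det)⁻¹) μ :=
    h1.aemeasurable.inv.aestronglyMeasurable
  -- The adjugate formula also covers singular matrices, where the inverse determinant is 0 by
  -- convention, so measurability needs no exceptional set.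
  simp only [Matrix.inv_def, Ring.inverse_eq_inv]
  exact h3.smul h2

theorem integrable_trace_re {K : ℝ → Matrix (Fin T) (Fin T) ℂ}
    (hK : ∀ i j, Integrable (fun x => K x i j) freq) :
    Integrable (fun x => (K x).trace.re) freq :=
  (integrable_finsetSum _ fun i _ => hK i i).re

theorem Minimality.ae (hf : IsWeight f) (hg : IsWeight g) (hm : Minimality (f + g)) :
    ∀ᵐ x ∂freq, (f x).PosSemidef ∧ (g x).PosSemidef ∧ IsUnit (f x + g x) := by
  filter_upwards [hf.posSemidef, hg.posSemidef, hm.invertible] with x h1 h2 h3 using ⟨h1, h2, h3⟩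

theorem isWeight_inv (hf : IsWeight f) (hg : IsWeight g) (hm : Minimality (f + g)) :
    IsWeight fun x => (f x + g x)⁻¹ where
  integrable i j := by
    refine (hm.trace_integrable.re.const_mul 2).mono' (aestronglyMeasurable_entry
      (aestronglyMeasurable_matrix_inv (hf.add hg).aestronglyMeasurable) i j) ?_
    filter_upwards [hm.ae hf hg] with x hx
    exact norm_entry_le (hx.1.add hx.2.1).inv i j
  posSemidef := by
    filter_upwards [hm.ae hf hg] with x hx using (hx.1.add hx.2.1).inv

theorem integrable_mul_inv (hf : IsWeight f) (hg : IsWeight g) (hm : Minimality (f + g))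
    (i j : Fin T) : Integrable (fun x => (f x * (f x + g x)⁻¹) i j) freq := by
  refine ((integrable_trace_re hf.integrable).add hm.trace_integrable.re).mono'
    (aestronglyMeasurable_entry (aestronglyMeasurable_matrix_mul hf.aestronglyMeasurable
      (isWeight_inv hf hg hm).aestronglyMeasurable) i j) ?_
  filter_upwards [hm.ae hf hg] with x hx
  exact norm_mul_inv_entry_le hx.1 hx.2.1 hx.2.2 i j

theorem integrable_mul_inv_mul (hf : IsWeight f) (hg : IsWeight g) (hm : Minimality (f + g))
    (i j : Fin T) : Integrable (fun x => (f x * (f x + g x)⁻¹ * g x) i j) freq := by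
  refine ((integrable_trace_re hf.integrable).const_mul 2).mono'
    (aestronglyMeasurable_entry (aestronglyMeasurable_matrix_mul
      (aestronglyMeasurable_matrix_mul hf.aestronglyMeasurable
        (isWeight_inv hf hg hm).aestronglyMeasurable) hg.aestronglyMeasurable) i j) ?_
  filter_upwards [hm.ae hf hg] with x hx
  exact norm_mul_inv_mul_entry_le hx.1 hx.2.1 hx.2.2 i j

variable {S : Finset ℤ}

theorem trigPoly_dotProduct (K : Matrix (Fin T) (Fin T) ℂ) (b c : S × Fin T → ℂ) (x : ℝ) :
    trigPoly b x ⬝ᵥ K.mulVec (star (trigPoly c x)) = ∑ k : S × Fin T, ∑ j : S × Fin T,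
      star (c k) * b j * (expo ((j.1 : ℤ) - (k.1 : ℤ)) x * K j.2 k.2) := by
  have e : ∀ (k : S × Fin T) (j : S × Fin T), expo ((j.1 : ℤ) - (k.1 : ℤ)) x =
      expo j.1 x * star (expo k.1 x) := fun k j => by
    rw [star_expo, ← expo_add, sub_eq_add_neg]
  simp only [e, Fintype.sum_prod_type, dotProduct, Matrix.mulVec, trigPoly, Pi.star_apply,
    star_sum, star_mul', Finset.mul_sum, Finset.sum_mul]
  have e1 : ∀ F : Fin T → Fin T → S → S → ℂ, ∑ ν, ∑ μ, ∑ k : S, ∑ j : S, F ν μ k j =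
      ∑ k : S, ∑ μ, ∑ j : S, ∑ ν, F ν μ k j := fun F => by
    rw [Finset.sum_congr rfl fun ν _ => Finset.sum_comm, Finset.sum_comm]
    refine Finset.sum_congr rfl fun k _ => ?_
    rw [Finset.sum_comm]
    exact Finset.sum_congr rfl fun μ _ => Finset.sum_comm
  rw [e1]
  refine Finset.sum_congr rfl fun k _ => Finset.sum_congr rfl fun μ _ =>
    Finset.sum_congr rfl fun j _ => Finset.sum_congr rfl fun ν _ => ?_
  ring

theorem integrable_trigPoly_dotProduct {K : ℝ → Matrix (Fin T) (Fin T) ℂ}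
    (hK : ∀ i j, Integrable (fun x => K x i j) freq) (b c : S × Fin T → ℂ) :
    Integrable (fun x => trigPoly b x ⬝ᵥ (K x).mulVec (star (trigPoly c x))) freq := by
  simp only [trigPoly_dotProduct]
  exact integrable_finsetSum _ fun k _ => integrable_finsetSum _ fun j _ =>
    (integrable_expo_mul (hK _ _) _).const_mul _

/-- Links the block matrices to integrals: each represents the form of its weight on polynomials
with frequencies in S. The form hᵀKk̄ is linear in its left argument, which accounts for the
transpose in the blocks. -/
theorem pairing_trigPoly {K : ℝ → Matrix (Fin T) (Fin T) ℂ}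
    (hK : ∀ i j, Integrable (fun x => K x i j) freq) (b c : S × Fin T → ℂ) :
    pairing K (trigPoly b) (trigPoly c) = star c ⬝ᵥ (blockMatrix S K).mulVec b := by
  have hi : ∀ k j : S × Fin T, Integrable (fun x => star (c k) * b j *
      (expo ((j.1 : ℤ) - (k.1 : ℤ)) x * K x j.2 k.2)) freq := fun k j =>
    (integrable_expo_mul (hK _ _) _).const_mul _
  simp only [pairing, trigPoly_dotProduct]
  rw [integral_finsetSum _ fun k _ => integrable_finsetSum _ fun j _ => hi k j, Finset.mul_sum]
  simp only [dotProduct, Matrix.mulVec, Finset.mul_sum]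
  refine Finset.sum_congr rfl fun k _ => ?_
  rw [integral_finsetSum _ fun j _ => hi k j, Finset.mul_sum]
  refine Finset.sum_congr rfl fun j _ => ?_
  rw [integral_const_mul]
  simp only [blockMatrix, Matrix.of_apply, Matrix.transpose_apply, Pi.star_apply]
  simp only [mul_comm (expo _ _)]
  ring

theorem trigPoly_single (j : S) (ν : Fin T) :
    trigPoly (Pi.single (j, ν) 1) = expoVec (j : ℤ) ν := by
  funext x μ
  simp only [trigPoly, expoVec, Pi.single_apply, Prod.mk.injEq, ite_mul, one_mul, zero_mul]
  by_cases h : μ = ν <;> simp [h]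

theorem trigPoly_eq_sum (b : S × Fin T → ℂ) :
    trigPoly b = ∑ j : S, ∑ ν, b (j, ν) • expoVec (j : ℤ) ν := by
  funext x μ
  simp [trigPoly, expoVec, Finset.sum_apply, Pi.single_apply]

theorem IsWeight.const_one : IsWeight fun _ => (1 : Matrix (Fin T) (Fin T) ℂ) :=
  ⟨fun _ _ => integrable_const _, by filter_upwards with x using Matrix.PosSemidef.one⟩

/-- The Gram matrix of the exponentials is the identity. -/
theorem blockMatrix_one : blockMatrix S (fun _ => (1 : Matrix (Fin T) (Fin T) ℂ)) = 1 := by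
  ext k j
  have hpi : (2 * Real.pi : ℂ) ≠ 0 := by simp [Real.pi_ne_zero]
  simp only [blockMatrix, Matrix.of_apply, Matrix.transpose_one]
  rw [integral_const_mul, integral_expo, Matrix.one_apply, Matrix.one_apply]
  obtain ⟨k, κ⟩ := k
  obtain ⟨j, ν⟩ := j
  by_cases h1 : k = j
  · by_cases h2 : κ = ν
    · simp only [h1, h2, sub_self, if_true, one_mul]
      exact inv_mul_cancel₀ hpi
    · simp [h1, h2]
  · have h3 : (j : ℤ) - (k : ℤ) ≠ 0 := fun h => h1 (Subtype.ext (by omega))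
    simp [h1, h3]

theorem eq_zero_of_trigPoly_ae_eq_zero {b : S × Fin T → ℂ} (h : trigPoly b =ᵐ[freq] 0) :
    b = 0 := by
  have h1 := pairing_trigPoly (IsWeight.const_one (T := T)).integrable b b
  rw [blockMatrix_one, Matrix.one_mulVec, pairing, integral_congr_ae (g := 0)] at h1
  · simpa using h1.symm
  · filter_upwards [h] with x hx
    simp [hx]

theorem ae_eq_zero_of_normSq_eq_zero (hf : IsWeight f) (hu : ∀ᵐ x ∂freq, IsUnit (f x))
    (h : hf.l2) (h0 : normSq f h = 0) : (h : ℝ → Fin T → ℂ) =ᵐ[freq] 0 := by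
  rw [← hf.norm_emb_sq, sq_eq_zero_iff, norm_eq_zero] at h0
  have h1 := hf.coeFn_emb h
  rw [h0] at h1
  filter_upwards [h1, hf.posSemidef, hu,
    ae_nfreq_iff.1 (Lp.coeFn_zero (EuclideanSpace ℂ (Fin T)) 2 nfreq)] with x hx hp hux h2
  rw [h2] at hx
  have h3 : Matrix.vecMul ((h : ℝ → Fin T → ℂ) x) (msqrt (f x)) = 0 := by
    have := congrArg WithLp.ofLp hx
    simpa [rootMul] using this.symm
  have h4 : Matrix.vecMul ((h : ℝ → Fin T → ℂ) x) (f x) = 0 := by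
    rw [← msqrt_mul_self hp, ← Matrix.vecMul_vecMul, h3, Matrix.zero_vecMul]
  have hd := (Matrix.isUnit_iff_isUnit_det _).1 hux
  have := congrArg (fun v => Matrix.vecMul v (f x)⁻¹) h4
  simpa [Matrix.vecMul_vecMul, Matrix.mul_nonsing_inv _ hd] using this

/-- If B c = 0, then the polynomial C has zero norm in L₂((f + g)⁻¹). The weight is a.e. invertible,
so C = 0 a.e., and orthonormality of the exponentials gives c = 0. -/
theorem isUnit_matB (hf : IsWeight f) (hg : IsWeight g) (hm : Minimality (f + g)) :
    IsUnit (matB S f g) := by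
  have hw := isWeight_inv hf hg hm
  rw [← Matrix.mulVec_injective_iff_isUnit, ← Matrix.coe_mulVecLin, ← LinearMap.ker_eq_bot,
    LinearMap.ker_eq_bot']
  intro c hc
  have h1 := pairing_trigPoly hw.integrable c c
  rw [← matB, ← Matrix.mulVecLin_apply, hc, dotProduct_zero, pairing_self_eq_normSq hw,
    Complex.ofReal_eq_zero] at h1
  have hmem : MemL2 (fun x => (f x + g x)⁻¹) (trigPoly c) := by
    rw [trigPoly_eq_sum]
    exact hw.l2.sum_mem fun j _ => hw.l2.sum_mem fun ν _ =>
      hw.l2.smul_mem _ (hw.memL2_expoVec j ν)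
  refine eq_zero_of_trigPoly_ae_eq_zero (ae_eq_zero_of_normSq_eq_zero hw ?_ ⟨_, hmem⟩ h1)
  filter_upwards [hm.invertible] with x hx
  rw [Matrix.isUnit_nonsing_inv_iff]
  exact hx

end Blocks

/-! ### The spectral characteristic -/

section Spectral

open Matrix

variable {T : ℕ} {f g : ℝ → Matrix (Fin T) (Fin T) ℂ} {S : Finset ℤ}

theorem continuous_trigPoly (b : S × Fin T → ℂ) : Continuous (trigPoly b) := by
  unfold trigPoly
  exact continuous_pi fun ν => continuous_finsetSum _ fun j _ =>
    continuous_const.mul (continuous_expo _)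

theorem IsWeight.memL2_trigPoly (hf : IsWeight f) (b : S × Fin T → ℂ) :
    MemL2 f (trigPoly b) := by
  rw [trigPoly_eq_sum]
  exact hf.l2.sum_mem fun j _ => hf.l2.sum_mem fun ν _ =>
    hf.l2.smul_mem _ (hf.memL2_expoVec j ν)

theorem aestronglyMeasurable_vecMul {μ : Measure ℝ} {w : ℝ → Fin T → ℂ}
    {K : ℝ → Matrix (Fin T) (Fin T) ℂ} (hw : AEStronglyMeasurable w μ)
    (hK : AEStronglyMeasurable K μ) : AEStronglyMeasurable (fun x => w x ᵥ* K x) μ :=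
  (continuous_fst.matrix_vecMul continuous_snd).comp_aestronglyMeasurable (hw.prodMk hK)

/-- Both quadratic forms are nonnegative, so each is dominated by their sum. -/
theorem IsWeight.memL2_of_add (hf : IsWeight f) (hg : IsWeight g) {u : ℝ → Fin T → ℂ}
    (hu : MemL2 (f + g) u) : MemL2 f u ∧ MemL2 g u := by
  have hq : ∀ {k : ℝ → Matrix (Fin T) (Fin T) ℂ}, IsWeight k →
      AEStronglyMeasurable (quad k u) freq := fun {k} hk => by
    have h1 : Continuous fun p : (Fin T → ℂ) × Matrix (Fin T) (Fin T) ℂ =>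
        p.1 ⬝ᵥ p.2 *ᵥ star p.1 :=
      continuous_fst.dotProduct (continuous_snd.matrix_mulVec continuous_fst.star)
    exact h1.comp_aestronglyMeasurable (hu.1.prodMk hk.aestronglyMeasurable)
  have hadd : ∀ x, quad (f + g) u x = quad f u x + quad g u x := fun x => by
    simp [quad, Matrix.add_mulVec]
  have key : ∀ᵐ x ∂freq, ‖quad f u x‖ ≤ (quad (f + g) u x).re ∧
      ‖quad g u x‖ ≤ (quad (f + g) u x).re := by
    filter_upwards [hf.posSemidef, hg.posSemidef] with x h1 h2
    rw [hadd, quad_eq_norm h1, quad_eq_norm h2, Complex.norm_real, Complex.norm_real,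
      Complex.add_re, Complex.ofReal_re, Complex.ofReal_re, Real.norm_of_nonneg (by positivity),
      Real.norm_of_nonneg (by positivity)]
    constructor <;> nlinarith [sq_nonneg ‖rootMul f u x‖, sq_nonneg ‖rootMul g u x‖]
  exact ⟨⟨hu.1, hu.2.re.mono' (hq hf) (key.mono fun x h => h.1)⟩,
    ⟨hu.1, hu.2.re.mono' (hq hg) (key.mono fun x h => h.2)⟩⟩

/-- Membership in `L₂^{s-}(f)` in terms of the embedding. -/
theorem IsWeight.memL2Minus_iff (hf : IsWeight f) (h : hf.l2) :
    MemL2Minus S f h ↔ hf.emb h ∈ (Submodule.span ℂ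
      (Set.range fun p : {j : ℤ // j ∉ S} × Fin T =>
        hf.emb ⟨expoVec p.1 p.2, hf.memL2_expoVec p.1 p.2⟩)).topologicalClosure := by
  let e : {j : ℤ // j ∉ S} × Fin T → hf.l2 := fun p =>
    ⟨expoVec p.1 p.2, hf.memL2_expoVec p.1 p.2⟩
  have e1 : Submodule.span ℂ {q : ℝ → Fin T → ℂ | ∃ j : ℤ, j ∉ S ∧ ∃ ν, q = expoVec j ν} =
      (Submodule.span ℂ (Set.range e)).map hf.l2.subtype := by
    rw [Submodule.map_span]
    congr 1
    ext q
    constructor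
    · rintro ⟨j, hj, ν, rfl⟩
      exact ⟨_, ⟨(⟨j, hj⟩, ν), rfl⟩, rfl⟩
    · rintro ⟨_, ⟨p, rfl⟩, rfl⟩
      exact ⟨p.1, p.1.2, p.2, rfl⟩
  have e2 : Submodule.span ℂ (Set.range fun p => hf.emb (e p)) =
      (Submodule.span ℂ (Set.range e)).map hf.emb := by
    rw [Submodule.map_span, ← Set.range_comp]
    rfl
  have e3 : hf.emb h ∈ (Submodule.span ℂ (Set.range fun p => hf.emb (e p))).topologicalClosure ↔
      ∀ ε : ℝ, 0 < ε → ∃ p ∈ Submodule.span ℂ (Set.range e), ‖hf.emb h - hf.emb p‖ < ε := by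
    rw [e2, ← SetLike.mem_coe, Submodule.topologicalClosure_coe, Metric.mem_closure_iff]
    simp only [Submodule.map_coe, Set.exists_mem_image, SetLike.mem_coe, dist_eq_norm]
  refine Iff.trans ?_ e3.symm
  constructor
  · intro hh ε hε
    obtain ⟨p, hp, hpε⟩ := hh.2 (ε ^ 2) (by positivity)
    rw [e1] at hp
    obtain ⟨p, hp, rfl⟩ := hp
    refine ⟨p, hp, ?_⟩
    rw [Submodule.subtype_apply, hf.normSq_sub] at hpε
    exact lt_of_pow_lt_pow_left₀ 2 hε.le hpε
  · intro hh
    refine ⟨h.2, fun ε hε => ?_⟩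
    obtain ⟨p, hp, hpε⟩ := hh (Real.sqrt ε) (Real.sqrt_pos.2 hε)
    refine ⟨p, by rw [e1]; exact ⟨p, hp, rfl⟩, ?_⟩
    rw [hf.normSq_sub]
    exact (Real.lt_sqrt (norm_nonneg _)).1 hpε

/-- `wᵀ (f + g)⁻¹`. -/
def mulInv (f g : ℝ → Matrix (Fin T) (Fin T) ℂ) (w : ℝ → Fin T → ℂ) (x : ℝ) : Fin T → ℂ :=
  w x ᵥ* (f x + g x)⁻¹

/-- The weight cancels the inverse: pairing wᵀ(f + g)⁻¹ in L₂(f + g) is unweighted pairing with w.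
The computations with p and q rest on this. -/
theorem mulInv_dotProduct {w : ℝ → Fin T → ℂ} {x : ℝ} (hx : IsUnit (f x + g x))
    (v : Fin T → ℂ) : mulInv f g w x ⬝ᵥ (f + g) x *ᵥ v = w x ⬝ᵥ v := by
  have hd := (isUnit_iff_isUnit_det _).1 hx
  rw [mulInv, dotProduct_mulVec, vecMul_vecMul, Pi.add_apply, nonsing_inv_mul _ hd, vecMul_one]

theorem star_mulInv {w : ℝ → Fin T → ℂ} {x : ℝ} (hx : (f x + g x).PosSemidef) :
    star (mulInv f g w x) = (f x + g x)⁻¹ *ᵥ star (w x) := by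
  rw [mulInv, star_vecMul, hx.inv.isHermitian.eq]

theorem quad_mulInv {w : ℝ → Fin T → ℂ} {x : ℝ} (hx : IsUnit (f x + g x))
    (hp : (f x + g x).PosSemidef) :
    quad (f + g) (mulInv f g w) x = w x ⬝ᵥ (f x + g x)⁻¹ *ᵥ star (w x) := by
  rw [quad, mulInv_dotProduct hx, star_mulInv hp]

/-- The spectral characteristic of the projection of `∑ b_j ξ(j)` on the whole of the
observed sequence. -/
def fullChar (f g : ℝ → Matrix (Fin T) (Fin T) ℂ) (b : S × Fin T → ℂ) : ℝ → Fin T → ℂ :=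
  mulInv f g fun x => trigPoly b x ᵥ* f x

/-- The correction due to the missing observations. -/
def gapChar (f g : ℝ → Matrix (Fin T) (Fin T) ℂ) (c : S × Fin T → ℂ) : ℝ → Fin T → ℂ :=
  mulInv f g (trigPoly c)

theorem specChar_eq (a : ℤ → ℂ) :
    specChar S a f g = fullChar f g (aVec S a) - gapChar f g (cVec S a f g) := by
  funext x
  simp only [specChar, fullChar, gapChar, mulInv, Pi.sub_apply, sub_vecMul]

theorem memL2_gapChar (hf : IsWeight f) (hg : IsWeight g) (hm : Minimality (f + g))
    (c : S × Fin T → ℂ) : MemL2 (f + g) (gapChar f g c) := by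
  have hw := isWeight_inv hf hg hm
  refine ⟨aestronglyMeasurable_vecMul (continuous_trigPoly c).aestronglyMeasurable
    hw.aestronglyMeasurable, (integrable_trigPoly_dotProduct hw.integrable c c).congr ?_⟩
  filter_upwards [hm.ae hf hg] with x hx
  exact (quad_mulInv hx.2.2 (hx.1.add hx.2.1)).symm

theorem normSq_gapChar (hf : IsWeight f) (hg : IsWeight g) (hm : Minimality (f + g))
    (c : S × Fin T → ℂ) :
    (normSq (f + g) (gapChar f g c) : ℂ) = star c ⬝ᵥ (matB S f g).mulVec c := by
  rw [← pairing_self_eq_normSq (hf.add hg), matB,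
    ← pairing_trigPoly (isWeight_inv hf hg hm).integrable, pairing, pairing]
  congr 1
  refine integral_congr_ae ?_
  filter_upwards [hm.ae hf hg] with x hx
  exact quad_mulInv hx.2.2 (hx.1.add hx.2.1)

theorem trigPoly_mulVec_sub {x : ℝ} (hf : (f x).PosSemidef) (hg : (g x).PosSemidef)
    (hx : IsUnit (f x + g x)) (b : S × Fin T → ℂ) :
    trigPoly b x ⬝ᵥ f x *ᵥ star (trigPoly b x) -
      trigPoly b x ⬝ᵥ f x *ᵥ star (fullChar f g b x) =
    trigPoly b x ⬝ᵥ (f x * (f x + g x)⁻¹ * g x) *ᵥ star (trigPoly b x) := by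
  rw [fullChar, star_mulInv (hf.add hg), star_vecMul, hf.isHermitian.eq, mul_inv_mul_eq_sub hx,
    sub_mulVec, dotProduct_sub]
  simp only [mulVec_mulVec, mul_assoc]

theorem quad_fullChar {x : ℝ} (hf : (f x).PosSemidef) (hg : (g x).PosSemidef)
    (hx : IsUnit (f x + g x)) (b : S × Fin T → ℂ) :
    quad (f + g) (fullChar f g b) x = trigPoly b x ⬝ᵥ f x *ᵥ star (trigPoly b x) -
      trigPoly b x ⬝ᵥ (f x * (f x + g x)⁻¹ * g x) *ᵥ star (trigPoly b x) := by
  rw [← trigPoly_mulVec_sub hf hg hx, sub_sub_cancel, quad, fullChar, mulInv_dotProduct hx,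
    dotProduct_mulVec]

theorem memL2_fullChar (hf : IsWeight f) (hg : IsWeight g) (hm : Minimality (f + g))
    (b : S × Fin T → ℂ) : MemL2 (f + g) (fullChar f g b) := by
  refine ⟨aestronglyMeasurable_vecMul (aestronglyMeasurable_vecMul
    (continuous_trigPoly b).aestronglyMeasurable hf.aestronglyMeasurable)
    (isWeight_inv hf hg hm).aestronglyMeasurable,
    ((integrable_trigPoly_dotProduct hf.integrable b b).sub
      (integrable_trigPoly_dotProduct (integrable_mul_inv_mul hf hg hm) b b)).congr ?_⟩
  filter_upwards [hm.ae hf hg] with x hx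
  exact (quad_fullChar hx.1 hx.2.1 hx.2.2 b).symm

/-- The normal equations of the fully observed problem: p has the same correlations with every u as
A_s ζ has in the spectral domain, where only f contributes. -/
theorem pairing_fullChar (hm : Minimality (f + g)) (b : S × Fin T → ℂ) (u : ℝ → Fin T → ℂ) :
    pairing (f + g) (fullChar f g b) u = pairing f (trigPoly b) u := by
  rw [pairing, pairing]
  congr 1
  refine integral_congr_ae ?_
  filter_upwards [hm.invertible] with x hx
  rw [fullChar, mulInv_dotProduct hx, dotProduct_mulVec]

/-- After cancellation of the weight the pairing is the j-th Fourier coefficient of C, whose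
frequencies all lie in S. -/
theorem pairing_gapChar (hm : Minimality (f + g)) (c : S × Fin T → ℂ) {j : ℤ} (hj : j ∉ S)
    (ν : Fin T) : pairing (f + g) (gapChar f g c) (expoVec j ν) = 0 := by
  have e : ∀ᵐ x ∂freq, gapChar f g c x ⬝ᵥ (f + g) x *ᵥ star (expoVec j ν x) =
      ∑ k : S, c (k, ν) * expo ((k : ℤ) - j) x := by
    filter_upwards [hm.invertible] with x hx
    rw [gapChar, mulInv_dotProduct hx, expoVec, ← Pi.single_star, dotProduct_single, star_expo,
      trigPoly, Finset.sum_mul]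
    refine Finset.sum_congr rfl fun k _ => ?_
    rw [sub_eq_add_neg, expo_add, mul_assoc]
  rw [pairing, integral_congr_ae e, integral_finsetSum _ fun k _ => by
    simpa [mul_comm] using integrable_expo_mul (integrable_const (c (k, ν))) ((k : ℤ) - j)]
  rw [Finset.sum_eq_zero, mul_zero]
  intro k _
  have hk : (k : ℤ) - j ≠ 0 := fun h => hj (by rw [← sub_eq_zero.1 h]; exact k.2)
  rw [integral_const_mul, integral_expo, if_neg hk, mul_zero]

theorem integrable_trigPoly_vecMul {K : ℝ → Matrix (Fin T) (Fin T) ℂ}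
    (hK : ∀ i j, Integrable (fun x => K x i j) freq) (b : S × Fin T → ℂ) (ν : Fin T) :
    Integrable (fun x => (trigPoly b x ᵥ* K x) ν) freq := by
  simp only [vecMul, dotProduct, trigPoly, Finset.sum_mul, mul_assoc]
  exact integrable_finsetSum _ fun μ _ => integrable_finsetSum _ fun j _ =>
    (integrable_expo_mul (hK _ _) _).const_mul _

theorem integral_expo_vecMul {K : ℝ → Matrix (Fin T) (Fin T) ℂ}
    (hK : ∀ i j, Integrable (fun x => K x i j) freq) (b : S × Fin T → ℂ) (k : S) (ν : Fin T) :
    ∫ x, expo (-k) x * (trigPoly b x ᵥ* K x) ν ∂freq =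
      2 * Real.pi * (blockMatrix S K *ᵥ b) (k, ν) := by
  have h := pairing_trigPoly hK b (Pi.single (k, ν) 1)
  rw [trigPoly_single, ← Pi.single_star, star_one, single_one_dotProduct, pairing] at h
  rw [← h, mul_inv_cancel_left₀ (by simp [Real.pi_ne_zero])]
  congr 1
  funext x
  rw [expoVec, ← Pi.single_star, dotProduct_mulVec, dotProduct_single, star_expo, mul_comm]

theorem specChar_eq_vecMul (a : ℤ → ℂ) (x : ℝ) : specChar S a f g x =
    trigPoly (aVec S a) x ᵥ* (f x * (f x + g x)⁻¹) -
      trigPoly (cVec S a f g) x ᵥ* (f x + g x)⁻¹ := by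
  rw [specChar, sub_vecMul, vecMul_vecMul]

theorem integrable_specChar (hf : IsWeight f) (hg : IsWeight g) (hm : Minimality (f + g))
    (a : ℤ → ℂ) (ν : Fin T) : Integrable (fun x => specChar S a f g x ν) freq := by
  simp only [specChar_eq_vecMul]
  exact (integrable_trigPoly_vecMul (integrable_mul_inv hf hg hm) _ ν).sub
    (integrable_trigPoly_vecMul (isWeight_inv hf hg hm).integrable _ ν)

/-- The Fourier coefficients of the spectral characteristic vanish on `S`. -/
theorem integral_expo_specChar (hf : IsWeight f) (hg : IsWeight g) (hm : Minimality (f + g))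
    (a : ℤ → ℂ) {k : ℤ} (hk : k ∈ S) (ν : Fin T) :
    ∫ x, expo (-k) x * specChar S a f g x ν ∂freq = 0 := by
  have h1 := integrable_mul_inv hf hg hm
  have h2 := (isWeight_inv hf hg hm).integrable
  simp only [specChar_eq_vecMul, Pi.sub_apply, mul_sub]
  rw [integral_sub (integrable_expo_mul (integrable_trigPoly_vecMul h1 _ ν) _)
    (integrable_expo_mul (integrable_trigPoly_vecMul h2 _ ν) _),
    integral_expo_vecMul h1 _ ⟨k, hk⟩, integral_expo_vecMul h2 _ ⟨k, hk⟩, ← mul_sub,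
    ← Pi.sub_apply]
  have hd := (isUnit_iff_isUnit_det _).1 (isUnit_matB (S := S) hf hg hm)
  -- The coefficients on S are 2π(D a - B c), and c solves B c = D a.
  change _ * ((matD S f g *ᵥ _) - (matB S f g *ᵥ cVec S a f g)) _ = 0
  rw [cVec, mulVec_mulVec, mul_nonsing_inv _ hd, one_mulVec, sub_self, Pi.zero_apply, mul_zero]

theorem memL2_specChar (hf : IsWeight f) (hg : IsWeight g) (hm : Minimality (f + g))
    (a : ℤ → ℂ) : MemL2 (f + g) (specChar S a f g) := by
  rw [specChar_eq]
  exact (hf.add hg).l2.sub_mem (memL2_fullChar hf hg hm _) (memL2_gapChar hf hg hm _)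

theorem memL2Minus_specChar (hf : IsWeight f) (hg : IsWeight g) (hm : Minimality (f + g))
    (a : ℤ → ℂ) : MemL2Minus S (f + g) (specChar S a f g) := by
  rw [(hf.add hg).memL2Minus_iff ⟨_, memL2_specChar hf hg hm a⟩]
  exact (hf.add hg).emb_mem_closure_expo_compl S _ (integrable_specChar hf hg hm a)
    fun j hj ν => integral_expo_specChar hf hg hm a hj ν

/-- Completing the square. -/
theorem specError_eq (hf : IsWeight f) (hg : IsWeight g) (hm : Minimality (f + g))
    (a : ℤ → ℂ) {u : ℝ → Fin T → ℂ} (hu : MemL2 (f + g) u) :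
    (specError S a f g u : ℂ) = normSq (f + g) (fullChar f g (aVec S a) - u) +
      star (aVec S a) ⬝ᵥ (matR S f g).mulVec (aVec S a) := by
  have hF := hf.add hg
  obtain ⟨u1, u2⟩ := hf.memL2_of_add hg hu
  have hA := hf.memL2_trigPoly (aVec S a)
  have hp := memL2_fullChar hf hg hm (aVec S a)
  have hp1 := (hf.memL2_of_add hg hp).1
  set A := trigPoly (aVec S a)
  set p := fullChar f g (aVec S a)
  -- R accounts for what is left of the f-norm of A_s after the part ‖p‖² explained by the whole
  -- observed sequence.
  have hR : star (aVec S a) ⬝ᵥ (matR S f g).mulVec (aVec S a) =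
      pairing f A A - pairing (f + g) p p := by
    rw [matR, ← pairing_trigPoly (integrable_mul_inv_mul hf hg hm), pairing_fullChar hm, pairing,
      pairing, pairing, ← mul_sub, ← integral_sub (hf.integrable_pairing hA hA)
        (hf.integrable_pairing hA hp1)]
    congr 1
    refine integral_congr_ae ?_
    filter_upwards [hm.ae hf hg] with x hx
    exact (trigPoly_mulVec_sub hx.1 hx.2.1 hx.2.2 _).symm
  -- Both squares ‖A_s - u‖² in L₂(f) and ‖p - u‖² in L₂(f + g) are expanded; their cross terms
  -- agree by `pairing_fullChar`.
  have hsub : ∀ {k : ℝ → Matrix (Fin T) (Fin T) ℂ} (hk : IsWeight k) {v w : ℝ → Fin T → ℂ},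
      MemL2 k v → MemL2 k w → (normSq k (v - w) : ℂ) =
        pairing k v v - pairing k v w - star (pairing k v w) + pairing k w w := by
    intro k hk v w hv hw
    rw [hk.normSq_sub ⟨v, hv⟩ ⟨w, hw⟩]
    have := inner_self_eq_norm_sq_to_K (𝕜 := ℂ) (hk.emb ⟨v, hv⟩ - hk.emb ⟨w, hw⟩)
    push_cast
    refine this.symm.trans ?_
    rw [inner_sub_left, inner_sub_right, inner_sub_right,
      ← inner_conj_symm (hk.emb ⟨v, hv⟩) (hk.emb ⟨w, hw⟩)]
    simp only [hk.inner_emb, starRingEnd_apply]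
    ring
  rw [specError, hR, Complex.ofReal_add, hsub hf hA u1, hsub hF hp hu, pairing_fullChar hm _ u,
    pairing_add hf hg u1 u1 u2 u2, pairing_self_eq_normSq hg]
  ring

theorem inner_emb_gapChar (hf : IsWeight f) (hg : IsWeight g) (hm : Minimality (f + g))
    (c : S × Fin T → ℂ) (u : (hf.add hg).l2) (hu : MemL2Minus S (f + g) u) :
    inner ℂ ((hf.add hg).emb ⟨_, memL2_gapChar hf hg hm c⟩) ((hf.add hg).emb u) = 0 := by
  rw [(hf.add hg).memL2Minus_iff] at hu
  refine inner_eq_zero_of_mem_closure_span ?_ hu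
  rintro _ ⟨q, rfl⟩
  rw [inner_eq_zero_symm]
  exact ((hf.add hg).inner_emb _ _).trans (pairing_gapChar hm c q.1.2 q.2)

/-- Write p - u = q + (h - u) with h the characteristic of the theorem. Both h and u lie in
L₂^{s-}(f + g), to which q is orthogonal, so Pythagoras splits the error into ⟨a, R a⟩ + ‖q‖² and
the excess ‖h - u‖². -/
theorem specError_eq_add (hf : IsWeight f) (hg : IsWeight g) (hm : Minimality (f + g))
    (a : ℤ → ℂ) {u : ℝ → Fin T → ℂ} (hu : MemL2Minus S (f + g) u) :
    (specError S a f g u : ℂ) = normSq (f + g) (u - specChar S a f g) + errorValue S a f g := by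
  have hF := hf.add hg
  have hp := memL2_fullChar hf hg hm (aVec S a)
  have hq := memL2_gapChar hf hg hm (cVec S a f g)
  have hs := memL2_specChar (S := S) hf hg hm a
  have h1 := inner_emb_gapChar hf hg hm (cVec S a f g) ⟨_, hs⟩ (memL2Minus_specChar hf hg hm a)
  have h2 := inner_emb_gapChar hf hg hm (cVec S a f g) ⟨u, hu.1⟩ hu
  have e : hF.emb ⟨_, hp⟩ - hF.emb ⟨u, hu.1⟩ =
      hF.emb ⟨_, hq⟩ + (hF.emb ⟨_, hs⟩ - hF.emb ⟨u, hu.1⟩) := by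
    rw [← add_sub_assoc, ← map_add]
    congr 2
    exact Subtype.ext (by simp [specChar_eq])
  have h3 : normSq (f + g) (fullChar f g (aVec S a) - u) =
      normSq (f + g) (gapChar f g (cVec S a f g)) + normSq (f + g) (u - specChar S a f g) := by
    rw [hF.normSq_sub ⟨_, hp⟩ ⟨u, hu.1⟩, hF.normSq_sub ⟨u, hu.1⟩ ⟨_, hs⟩, e,
      norm_sub_rev (hF.emb ⟨u, hu.1⟩)]
    have h4 := norm_add_sq (𝕜 := ℂ) (hF.emb ⟨_, hq⟩) (hF.emb ⟨_, hs⟩ - hF.emb ⟨u, hu.1⟩)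
    rw [inner_sub_right, h1, h2, sub_zero, map_zero, mul_zero, add_zero, hF.norm_emb_sq ⟨_, hq⟩]
      at h4
    exact h4
  rw [specError_eq hf hg hm a hu.1, h3, Complex.ofReal_add, normSq_gapChar hf hg hm, errorValue]
  ring

theorem specError_specChar (hf : IsWeight f) (hg : IsWeight g) (hm : Minimality (f + g))
    (a : ℤ → ℂ) : (specError S a f g (specChar S a f g) : ℂ) = errorValue S a f g := by
  rw [specError_eq_add hf hg hm a (memL2Minus_specChar hf hg hm a), sub_self]
  simp [normSq, quad]

theorem MemL2Minus.congr {h k : ℝ → Fin T → ℂ} (hh : MemL2Minus S f h) (e : h =ᵐ[freq] k) :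
    MemL2Minus S f k := by
  have hn : ∀ p, normSq f (k - p) = normSq f (h - p) := fun p => by
    rw [normSq, normSq]
    congr 1
    refine integral_congr_ae ?_
    filter_upwards [e] with x hx
    simp [quad, hx]
  refine ⟨⟨hh.1.1.congr e, hh.1.2.congr ?_⟩, fun ε hε => ?_⟩
  · filter_upwards [e] with x hx
    simp [quad, hx]
  · obtain ⟨p, hp, hpε⟩ := hh.2 ε hε
    exact ⟨p, hp, by rwa [hn]⟩

/-- A minimizer has zero excess, and a.e. invertibility of f + g turns zero norm into a.e. equality;
conversely everything involved depends only on the a.e. class. -/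
theorem isSpectralCharacteristic_iff (hf : IsWeight f) (hg : IsWeight g)
    (hm : Minimality (f + g)) (a : ℤ → ℂ) (h : ℝ → Fin T → ℂ) :
    IsSpectralCharacteristic S a f g h ↔ h =ᵐ[freq] specChar S a f g := by
  have hF := hf.add hg
  have hs := memL2Minus_specChar (S := S) hf hg hm a
  have key : ∀ u, MemL2Minus S (f + g) u → specError S a f g u =
      normSq (f + g) (u - specChar S a f g) + specError S a f g (specChar S a f g) := by
    intro u hu
    have h1 := specError_eq_add hf hg hm a hu
    rw [← specError_specChar hf hg hm a, ← Complex.ofReal_add] at h1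
    exact Complex.ofReal_injective h1
  have hnn : ∀ u, MemL2Minus S (f + g) u → 0 ≤ normSq (f + g) (u - specChar S a f g) := by
    intro u hu
    rw [hF.normSq_sub ⟨u, hu.1⟩ ⟨_, hs.1⟩]
    positivity
  constructor
  · rintro ⟨hh, hmin⟩
    have h1 := hmin _ hs
    rw [key h hh] at h1
    have h2 := le_antisymm (by linarith) (hnn h hh)
    have h3 := ae_eq_zero_of_normSq_eq_zero hF hm.invertible
      ⟨h - specChar S a f g, hF.l2.sub_mem hh.1 hs.1⟩ h2
    filter_upwards [h3] with x hx
    simpa [sub_eq_zero] using hx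
  · intro e
    have hh := hs.congr e.symm
    refine ⟨hh, fun u hu => ?_⟩
    have h0 : normSq (f + g) (h - specChar S a f g) = 0 := by
      have : quad (f + g) (h - specChar S a f g) =ᵐ[freq] 0 := by
        filter_upwards [e] with x hx
        simp [quad, hx]
      rw [normSq, integral_congr_ae (g := fun _ => 0), integral_zero, mul_zero]
      filter_upwards [this] with x hx
      simp [hx]
    rw [key u hu, key h hh, h0]
    linarith [hnn u hu]

theorem specChar_eq_sub (hm : Minimality (f + g)) (a : ℤ → ℂ) :
    ∀ᵐ x ∂freq, specChar S a f g x = trigPoly (aVec S a) x -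
      (trigPoly (aVec S a) x ᵥ* g x + trigPoly (cVec S a f g) x) ᵥ* (f x + g x)⁻¹ := by
  filter_upwards [hm.invertible] with x hx
  have hd := (isUnit_iff_isUnit_det _).1 hx
  have e : trigPoly (aVec S a) x =
      (trigPoly (aVec S a) x ᵥ* f x + trigPoly (aVec S a) x ᵥ* g x) ᵥ* (f x + g x)⁻¹ := by
    rw [← vecMul_add, vecMul_vecMul]
    erw [mul_nonsing_inv _ hd]
    rw [vecMul_one]
  rw [specChar]
  nth_rewrite 2 [e]
  rw [← sub_vecMul]
  congr 1
  abel

end Spectral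

/-! ### Roots of unity -/

section Roots

variable {T : ℕ}

/-- `exp (2 π i k / T)`. -/
def unityRoot (T : ℕ) (k : ℤ) : ℂ := Complex.exp (2 * Real.pi * Complex.I * k / T)

theorem unityRoot_add (k l : ℤ) : unityRoot T (k + l) = unityRoot T k * unityRoot T l := by
  rw [unityRoot, unityRoot, unityRoot, ← Complex.exp_add]
  push_cast
  ring_nf

theorem star_unityRoot (k : ℤ) : star (unityRoot T k) = unityRoot T (-k) := by
  rw [unityRoot, unityRoot, Complex.star_def, ← Complex.exp_conj]
  simp [map_ofNat]

theorem norm_unityRoot (k : ℤ) : ‖unityRoot T k‖ = 1 := by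
  have : 2 * Real.pi * Complex.I * k / T = ((2 * Real.pi * k / T : ℝ) : ℂ) * Complex.I := by
    push_cast; ring
  rw [unityRoot, this, Complex.norm_exp_ofReal_mul_I]

theorem unityRoot_eq_one_iff (hT : 0 < T) (k : ℤ) : unityRoot T k = 1 ↔ (T : ℤ) ∣ k := by
  have hT' : (T : ℂ) ≠ 0 := by exact_mod_cast hT.ne'
  rw [unityRoot, Complex.exp_eq_one_iff]
  constructor
  · rintro ⟨n, hn⟩
    refine ⟨n, ?_⟩
    rw [div_eq_iff hT'] at hn
    have h2 : (2 * Real.pi * Complex.I) * (k : ℂ) = (2 * Real.pi * Complex.I) * ((T * n : ℤ) : ℂ) := by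
      rw [hn]; push_cast; ring
    exact_mod_cast mul_left_cancel₀ Complex.two_pi_I_ne_zero h2
  · rintro ⟨n, rfl⟩
    refine ⟨n, ?_⟩
    push_cast
    field_simp

theorem unityRoot_pow (k : ℤ) (i : ℕ) : unityRoot T k ^ i = unityRoot T (k * i) := by
  rw [unityRoot, unityRoot, ← Complex.exp_nat_mul]
  push_cast
  ring_nf

theorem sum_unityRoot (hT : 0 < T) (k : ℤ) :
    ∑ i ∈ Finset.range T, unityRoot T (k * i) = if (T : ℤ) ∣ k then (T : ℂ) else 0 := by
  simp only [← unityRoot_pow]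
  split_ifs with h
  · simp [(unityRoot_eq_one_iff hT k).2 h]
  · rw [geom_sum_eq (fun h' => h ((unityRoot_eq_one_iff hT k).1 h')), unityRoot_pow,
      (unityRoot_eq_one_iff hT _).2 (dvd_mul_left _ _), sub_self, zero_div]

theorem rootChar_eq (n : ℤ) (ν : Fin T) : rootChar T n ν = unityRoot T (n * ((ν : ℕ) + 1)) := by
  rw [rootChar, unityRoot]
  push_cast
  ring_nf

theorem rootChar_add (m n : ℤ) (ν : Fin T) :
    rootChar T (m + n) ν = rootChar T m ν * rootChar T n ν := by
  simp only [rootChar_eq, add_mul, unityRoot_add]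

theorem star_rootChar (n : ℤ) (ν : Fin T) : star (rootChar T n ν) = rootChar T (-n) ν := by
  simp only [rootChar_eq, star_unityRoot, neg_mul]

theorem rootChar_eq_one_of_dvd (hT : 0 < T) {n : ℤ} (h : (T : ℤ) ∣ n) (ν : Fin T) :
    rootChar T n ν = 1 := by
  rw [rootChar_eq, unityRoot_eq_one_iff hT]
  exact h.mul_right _

theorem sum_rootChar (hT : 0 < T) (k : ℤ) :
    ∑ ν : Fin T, rootChar T k ν = if (T : ℤ) ∣ k then (T : ℂ) else 0 := by
  have e : ∀ ν : Fin T, rootChar T k ν = unityRoot T k * unityRoot T (k * (ν : ℕ)) := fun ν => by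
    rw [rootChar_eq, ← unityRoot_add]
    ring_nf
  simp only [e]
  rw [Fin.sum_univ_eq_sum_range (fun i => unityRoot T k * unityRoot T (k * i)), ← Finset.mul_sum,
    sum_unityRoot hT]
  split_ifs with h
  · rw [(unityRoot_eq_one_iff hT k).2 h, one_mul]
  · rw [mul_zero]

theorem sum_range_rootChar (hT : 0 < T) (n : ℤ) (ν μ : Fin T) :
    ∑ r ∈ Finset.range T, rootChar T (-(n + r)) ν * rootChar T (n + r) μ =
      if ν = μ then (T : ℂ) else 0 := by
  have e : ∀ r : ℕ, rootChar T (-(n + r)) ν * rootChar T (n + r) μ =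
      unityRoot T (n * ((μ : ℕ) - (ν : ℕ))) * unityRoot T (((μ : ℕ) - (ν : ℕ)) * r) := fun r => by
    rw [rootChar_eq, rootChar_eq, ← unityRoot_add, ← unityRoot_add]
    ring_nf
  simp only [e]
  rw [← Finset.mul_sum, sum_unityRoot hT]
  by_cases h : ν = μ
  · subst h
    simp [unityRoot]
  · have hd : ¬ (T : ℤ) ∣ ((μ : ℕ) : ℤ) - ((ν : ℕ) : ℤ) := fun hd => by
      have := Int.eq_zero_of_abs_lt_dvd hd (by rw [abs_lt]; omega)
      exact h (Fin.ext (by omega))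
    simp [h, hd]

/-- The shift of indices by one in `rootChar` cancels in the difference ν - μ, so the cyclic
covariance can be written with either numbering. -/
theorem exp_sub_eq_rootChar (ν μ : Fin T) (r : ℕ) :
    Complex.exp (-(2 * Real.pi * Complex.I * (((ν : ℤ) - (μ : ℤ) : ℤ) : ℂ) * r / T)) =
      rootChar T (-r) ν * rootChar T r μ := by
  rw [rootChar, rootChar, ← Complex.exp_add]
  push_cast
  ring_nf

theorem sum_range_shift (F : ℤ → ℂ) (hF : ∀ k, F (k + T) = F k) (n : ℤ) :
    ∑ r ∈ Finset.range T, F (n + r) = ∑ r ∈ Finset.range T, F r := by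
  have step : ∀ n : ℤ, ∑ r ∈ Finset.range T, F (n + 1 + r) = ∑ r ∈ Finset.range T, F (n + r) := by
    intro n
    have h1 := Finset.sum_range_succ (fun r : ℕ => F (n + r)) T
    have h2 := Finset.sum_range_succ' (fun r : ℕ => F (n + r)) T
    rw [h1, hF] at h2
    simp only [Nat.cast_zero, add_zero, add_left_inj] at h2
    rw [h2]
    refine Finset.sum_congr rfl fun r _ => ?_
    congr 1
    push_cast
    ring
  induction n using Int.induction_on with
  | zero => simp
  | succ n ih => rw [step, ih]
  | pred n ih => rw [← ih, ← step (-n - 1), sub_add_cancel]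

end Roots

/-! ### Gladyshev generating sequences -/

section Gladyshev

variable {Ω : Type u} [MeasurableSpace Ω] {P : Measure Ω} {T : ℕ}

/-- The sequence `∑ ν, exp (2 π i (n + r) ν / T) ξ_ν(n)` is uncorrelated with `ζ` unless
`T ∣ r`. -/
theorem IsGladyshevGenerating.inner_eq_zero (hT : 0 < T) {ζ : ℤ → Lp ℂ 2 P}
    {ξ : ℤ → Fin T → Lp ℂ 2 P} (h : IsGladyshevGenerating ζ ξ) {r : ℤ} (hr : ¬ (T : ℤ) ∣ r)
    (n m : ℤ) : inner ℂ (ζ m) (∑ ν, rootChar T (n + r) ν • ξ n ν) = 0 := by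
  rw [h.repr m]
  simp only [sum_inner, inner_sum, inner_smul_left, inner_smul_right, ← cov_eq_inner,
    h.covariance, cyclicCov, exp_sub_eq_rootChar, starRingEnd_apply, star_rootChar,
    Finset.mul_sum]
  rw [Finset.sum_congr rfl fun ν _ => Finset.sum_comm, Finset.sum_comm]
  refine Finset.sum_eq_zero fun ρ _ => ?_
  -- For fixed ρ the sum over ν and μ factors into two character sums. They are nonzero only if T
  -- divides r + m - ρ and ρ - m, hence r.
  have e : ∀ ν μ : Fin T, rootChar T (n + r) ν * (rootChar T (-m) μ * ((T : ℂ)⁻¹ *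
      rootChar T (-(n - m)) ν * ((T : ℂ)⁻¹ * (rootChar T (-ρ) ν * rootChar T ρ μ *
        cov (ζ (ρ + (n - m))) (ζ ρ))))) = (T : ℂ)⁻¹ * (T : ℂ)⁻¹ * cov (ζ (ρ + (n - m))) (ζ ρ) *
      (rootChar T (r + m - ρ) ν * rootChar T (ρ - m) μ) := fun ν μ => by
    have e1 : r + m - (ρ : ℤ) = (n + r) + (-(n - m) + -ρ) := by ring
    have e2 : (ρ : ℤ) - m = -m + ρ := by ring
    rw [e1, e2, rootChar_add (n + r), rootChar_add (-(n - m)), rootChar_add (-m)]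
    ring
  simp only [e, ← Finset.mul_sum, ← Finset.sum_mul, sum_rootChar hT]
  by_cases h1 : (T : ℤ) ∣ r + m - ρ
  · have h2 : ¬ (T : ℤ) ∣ ρ - m := fun h2 => hr (by simpa using h1.add h2)
    simp [h2]
  · simp [h1]

/-- Fourier inversion on ℤ/T: the T modulated sums recover the components. For a generating sequence
the sum with r = 0 is ζ(n) itself. -/
theorem component_eq_sum (hT : 0 < T) (ξ : ℤ → Fin T → Lp ℂ 2 P) (n : ℤ) (ν : Fin T) :
    ξ n ν = ∑ r ∈ Finset.range T,
      ((T : ℂ)⁻¹ * rootChar T (-(n + r)) ν) • ∑ μ, rootChar T (n + r) μ • ξ n μ := by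
  have hT' : (T : ℂ) ≠ 0 := by exact_mod_cast hT.ne'
  simp only [Finset.smul_sum, smul_smul]
  rw [Finset.sum_comm]
  simp only [← Finset.sum_smul, mul_assoc, ← Finset.mul_sum, sum_range_rootChar hT, mul_ite,
    mul_zero, inv_mul_cancel₀ hT', ite_smul, one_smul, zero_smul, Finset.sum_ite_eq,
    Finset.mem_univ, if_true]

/-- An extension of the probability space by an independent uniform variable on `T` points. -/
theorem exists_extension (hT : 0 < T) (P : Measure Ω) [IsProbabilityMeasure P] :
    ∃ (Ω' : Type u) (_ : MeasurableSpace Ω') (P' : Measure Ω') (_ : IsProbabilityMeasure P')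
      (p : Ω' → Ω) (hp : MeasurePreserving p P' P) (ten : ℕ → Lp ℂ 2 P → Lp ℂ 2 P'),
      (∀ X, ten 0 X = lift p hp X) ∧
      (∀ r X, mean X = 0 → mean (ten r X) = 0) ∧
      ∀ r s X Y, r < T → s < T → cov (ten r X) (ten s Y) = if r = s then cov X Y else 0 := by
  have : Nonempty (Fin T) := ⟨⟨0, hT⟩⟩
  let Q : Measure (Fin T) := (PMF.uniformOfFintype (Fin T)).toMeasure
  have hQ : ∀ F : Fin T → ℂ, ∫ u, F u ∂Q = (T : ℂ)⁻¹ * ∑ u, F u := fun F => by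
    rw [PMF.integral_eq_sum]
    simp [Finset.mul_sum]
  let p : Ω × Fin T → Ω := Prod.fst
  have hp : MeasurePreserving p (P.prod Q) P := measurePreserving_fst
  have hlift : ∀ X : Lp ℂ 2 P, ∀ᵐ w ∂(P.prod Q), lift p hp X w = X w.1 := fun X =>
    Lp.coeFn_compMeasurePreserving X hp
  -- The characters of ℤ/T are orthonormal for the uniform law, so the products X · e_r are T
  -- mutually uncorrelated copies; e_0 = 1 makes the copy r = 0 the lift.
  let e : ℕ → Fin T → ℂ := fun r u => unityRoot T (r * (u : ℕ))
  have hmem : ∀ r (X : Lp ℂ 2 P), MemLp (fun w => lift p hp X w * e r w.2) 2 (P.prod Q) :=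
    fun r X => (Lp.memLp (lift p hp X)).of_le
      ((Lp.aestronglyMeasurable _).mul ((measurable_from_top (f := e r)).comp
        measurable_snd).aestronglyMeasurable)
      (by filter_upwards with w; simp [e, norm_unityRoot])
  have hten : ∀ r (X : Lp ℂ 2 P), ∀ᵐ w ∂(P.prod Q), (hmem r X).toLp _ w = X w.1 * e r w.2 := by
    intro r X
    filter_upwards [(hmem r X).coeFn_toLp, hlift X] with w h1 h2
    rw [h1, h2]
  refine ⟨Ω × Fin T, inferInstance, P.prod Q, inferInstance, p, hp,
    fun r X => (hmem r X).toLp _, fun X => ?_, fun r X hX => ?_, fun r s X Y hr hs => ?_⟩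
  · refine Lp.ext ?_
    filter_upwards [hten 0 X, hlift X] with w h1 h2
    rw [h1, h2]
    simp [e, unityRoot]
  · rw [mean, integral_congr_ae (hten r X), integral_prod_mul (fun ω => X ω) (e r)]
    rw [mean] at hX
    rw [hX, zero_mul]
  · have e1 : ∀ᵐ w ∂(P.prod Q), (hmem r X).toLp _ w * star ((hmem s Y).toLp _ w) =
        (X w.1 * star (Y w.1)) * (e r w.2 * star (e s w.2)) := by
      filter_upwards [hten r X, hten s Y] with w h1 h2
      rw [h1, h2, star_mul']
      ring
    rw [cov, integral_congr_ae e1, integral_prod_mul (fun ω => X ω * star (Y ω))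
      (fun u => e r u * star (e s u)), hQ]
    have e2 : ∀ u : Fin T, e r u * star (e s u) = unityRoot T (((r : ℤ) - s) * (u : ℕ)) := by
      intro u
      simp only [e, star_unityRoot, ← unityRoot_add]
      ring_nf
    simp only [e2]
    rw [Fin.sum_univ_eq_sum_range (fun i => unityRoot T (((r : ℤ) - s) * (i : ℕ))),
      sum_unityRoot hT]
    have hT' : (T : ℂ) ≠ 0 := by exact_mod_cast hT.ne'
    by_cases h : r = s
    · simp [h, hT', cov]
    · have hd : ¬ (T : ℤ) ∣ (r : ℤ) - s := fun hd => by
        have := Int.eq_zero_of_abs_lt_dvd hd (by rw [abs_lt]; omega)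
        omega
      simp [h, hd]

/-- Gladyshev's sequence, built from `T` uncorrelated copies of `ζ`. -/
def gladyshevSeq {Ω' : Type u} [MeasurableSpace Ω'] {P' : Measure Ω'}
    (ten : ℕ → Lp ℂ 2 P → Lp ℂ 2 P') (ζ : ℤ → Lp ℂ 2 P) (n : ℤ) (ν : Fin T) : Lp ℂ 2 P' :=
  ∑ r ∈ Finset.range T, ((T : ℂ)⁻¹ * rootChar T (-(n + r)) ν) • ten r (ζ (n + r))

/-- Only equal copies correlate, which leaves a sum over one period of a T-periodic function
starting at m; moving the window to 0 gives the cyclic covariance, and stationarity can be read off.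
In the representation, summing over ν kills every copy except r = 0. -/
theorem isGladyshevGenerating_gladyshevSeq [IsProbabilityMeasure P] {Ω' : Type u}
    [MeasurableSpace Ω'] {P' : Measure Ω'} [IsProbabilityMeasure P'] {p : Ω' → Ω}
    {hp : MeasurePreserving p P' P} {ten : ℕ → Lp ℂ 2 P → Lp ℂ 2 P'}
    (h0 : ∀ X, ten 0 X = lift p hp X) (hmean : ∀ r X, mean X = 0 → mean (ten r X) = 0)
    (hcov : ∀ r s X Y, r < T → s < T →
      cov (ten r X) (ten s Y) = if r = s then cov X Y else 0)
    {ζ : ℤ → Lp ℂ 2 P} (hζ : IsPC T ζ) :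
    IsGladyshevGenerating (fun n => lift p hp (ζ n)) (gladyshevSeq (T := T) ten ζ) := by
  have hT := hζ.pos
  have hT' : (T : ℂ) ≠ 0 := by exact_mod_cast hT.ne'
  have hl : ∀ X Y, cov (lift p hp X) (lift p hp Y) = cov X Y := fun X Y => by
    rw [← h0, ← h0, hcov 0 0 X Y hT hT, if_pos rfl]
  have hcovariance : ∀ (n m : ℤ) (ν μ : Fin T),
      cov (gladyshevSeq (T := T) ten ζ n ν) (gladyshevSeq (T := T) ten ζ m μ) =
      (T : ℂ)⁻¹ * rootChar T (-(n - m)) ν *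
        cyclicCov T (fun n => lift p hp (ζ n)) ((ν : ℤ) - (μ : ℤ)) (n - m) := by
    intro n m ν μ
    let G : ℤ → ℂ := fun ρ => rootChar T (-(ρ + (n - m))) ν * rootChar T ρ μ *
      cov (ζ (ρ + (n - m))) (ζ ρ)
    have hG : ∀ k, G (k + T) = G k := fun k => by
      have e1 : -(k + T + (n - m)) = -(k + (n - m)) + -(T : ℤ) := by ring
      have e2 : k + T + (n - m) = k + (n - m) + T := by ring
      simp only [G]
      rw [e1, e2, rootChar_add (-(k + (n - m))), rootChar_add k,
        rootChar_eq_one_of_dvd hT (dvd_neg.2 dvd_rfl), rootChar_eq_one_of_dvd hT dvd_rfl,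
        hζ.periodic]
      ring
    have hL : cov (gladyshevSeq (T := T) ten ζ n ν) (gladyshevSeq (T := T) ten ζ m μ) =
        (T : ℂ)⁻¹ * (T : ℂ)⁻¹ * ∑ r ∈ Finset.range T, G (m + r) := by
      rw [cov_eq_inner, gladyshevSeq, gladyshevSeq, Finset.mul_sum]
      simp only [sum_inner, inner_sum, inner_smul_left, inner_smul_right, ← cov_eq_inner]
      refine Finset.sum_congr rfl fun r hr => ?_
      rw [Finset.sum_eq_single r]
      · rw [hcov r r _ _ (Finset.mem_range.1 hr) (Finset.mem_range.1 hr), if_pos rfl]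
        have e1 : m + r + (n - m) = n + r := by ring
        simp only [G, e1, map_mul, starRingEnd_apply, star_rootChar, star_inv₀, star_natCast,
          neg_neg]
        ring
      · intro s hs hne
        rw [hcov _ _ _ _ (Finset.mem_range.1 hr) (Finset.mem_range.1 hs), if_neg hne.symm,
          mul_zero]
      · intro h
        exact absurd hr h
    rw [hL, sum_range_shift G hG, cyclicCov]
    simp only [exp_sub_eq_rootChar, hl, Finset.mul_sum]
    refine Finset.sum_congr rfl fun r _ => ?_
    have e1 : -((r : ℤ) + (n - m)) = -(n - m) + -r := by ring
    simp only [G]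
    rw [e1, rootChar_add]
    ring
  refine ⟨⟨⟨fun n ν => ?_, fun n m k ν μ => ?_⟩, fun n => ?_⟩, hcovariance⟩
  · refine mean_eq_zero_of_mem_closedSpan
      (G := Set.range fun q : ℕ × ℤ => ten q.1 (ζ q.2)) ?_ ?_
    · rintro _ ⟨q, rfl⟩
      exact hmean _ _ (hζ.mean_zero _)
    · refine Submodule.le_topologicalClosure _ (Submodule.sum_mem _ fun r _ =>
        Submodule.smul_mem _ _ (Submodule.subset_span ⟨(r, n + r), rfl⟩))
  · rw [hcovariance, hcovariance, add_sub_add_right_eq_sub]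
  · simp only [gladyshevSeq, Finset.smul_sum, smul_smul]
    rw [Finset.sum_comm]
    simp only [← Finset.sum_smul]
    have e : ∀ r : ℕ, r ∈ Finset.range T →
        (∑ ν : Fin T, rootChar T n ν * ((T : ℂ)⁻¹ * rootChar T (-(n + r)) ν)) =
          if r = 0 then 1 else 0 := fun r hr => by
      have e1 : ∀ ν : Fin T, rootChar T n ν * ((T : ℂ)⁻¹ * rootChar T (-(n + r)) ν) =
          (T : ℂ)⁻¹ * rootChar T (-r) ν := fun ν => by
        rw [mul_left_comm, ← rootChar_add]
        ring_nf
      simp only [e1]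
      rw [← Finset.mul_sum, sum_rootChar hT]
      by_cases h : r = 0
      · simp [h, hT']
      · have hd : ¬ (T : ℤ) ∣ -(r : ℤ) := fun hd => by
          rw [dvd_neg, Int.natCast_dvd_natCast] at hd
          exact h (Nat.eq_zero_of_dvd_of_lt hd (Finset.mem_range.1 hr))
        rw [if_neg hd, if_neg h, mul_zero]
    rw [Finset.sum_congr rfl fun r hr => by rw [e r hr], Finset.sum_eq_single 0]
    · simp [h0]
    · intro r _ hr
      rw [if_neg hr, zero_smul]
    · intro h
      exact absurd (Finset.mem_range.2 hT) h

theorem exists_gladyshevGenerating [IsProbabilityMeasure P] {ζ θ : ℤ → Lp ℂ 2 P}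
    (hζ : IsPC T ζ) (hθ : IsPC T θ) (hζθ : ∀ n m, cov (ζ n) (θ m) = 0) :
    ∃ (Ω' : Type u) (_ : MeasurableSpace Ω') (P' : Measure Ω') (_ : IsProbabilityMeasure P')
      (p : Ω' → Ω) (hp : MeasurePreserving p P' P) (ξ η : ℤ → Fin T → Lp ℂ 2 P'),
      IsGladyshevGenerating (fun n => lift p hp (ζ n)) ξ ∧
      IsGladyshevGenerating (fun n => lift p hp (θ n)) η ∧
      ∀ n m ν μ, cov (ξ n ν) (η m μ) = 0 := by
  obtain ⟨Ω', mΩ', P', hP', p, hp, ten, h0, hmean, hcov⟩ := exists_extension hζ.pos P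
  refine ⟨Ω', mΩ', P', hP', p, hp, gladyshevSeq ten ζ, gladyshevSeq ten θ,
    isGladyshevGenerating_gladyshevSeq h0 hmean hcov hζ,
    isGladyshevGenerating_gladyshevSeq h0 hmean hcov hθ, fun n m ν μ => ?_⟩
  rw [cov_eq_inner, gladyshevSeq, gladyshevSeq]
  simp only [sum_inner, inner_sum, inner_smul_left, inner_smul_right, ← cov_eq_inner]
  refine Finset.sum_eq_zero fun r hr => ?_
  rw [Finset.sum_eq_zero, mul_zero]
  intro s hs
  rw [hcov _ _ _ _ (Finset.mem_range.1 hr) (Finset.mem_range.1 hs), hζθ, ite_self, mul_zero]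

end Gladyshev

/-! ### Optimal estimates -/

section Estimates

open Matrix

variable {Ω : Type u} [MeasurableSpace Ω] {P : Measure Ω} {T : ℕ}
  {f g : ℝ → Matrix (Fin T) (Fin T) ℂ} {ξ η : ℤ → Fin T → Lp ℂ 2 P} {ζ θ : ℤ → Lp ℂ 2 P}
  {S : Finset ℤ}

theorem inner_eq_zero_of_mem_closedSpan {G : Set (Lp ℂ 2 P)} {X Y : Lp ℂ 2 P}
    (h : ∀ Z ∈ G, inner ℂ Z X = 0) (hY : Y ∈ closedSpan G) : inner ℂ Y X = 0 :=
  inner_eq_zero_symm.1 (inner_eq_zero_of_mem_closure_span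
    (fun Z hZ => inner_eq_zero_symm.1 (h Z hZ)) hY)

theorem exists_orthogonal_estimate (G : Set (Lp ℂ 2 P)) (X : Lp ℂ 2 P) :
    ∃ Y ∈ closedSpan G, ∀ Z ∈ G, inner ℂ Z (X - Y) = 0 := by
  have : CompleteSpace (closedSpan G) :=
    (Submodule.isClosed_topologicalClosure _).completeSpace_coe
  refine ⟨(closedSpan G).orthogonalProjectionOnto X, Submodule.coe_mem _, fun Z hZ => ?_⟩
  rw [← Submodule.starProjection_apply]
  exact (Submodule.mem_orthogonal _ _).1 (Submodule.sub_starProjection_mem_orthogonal X) Z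
    (Submodule.le_topologicalClosure _ (Submodule.subset_span hZ))

theorem eq_of_orthogonal_estimate {G : Set (Lp ℂ 2 P)} {X Y Y' : Lp ℂ 2 P}
    (hY : Y ∈ closedSpan G) (hY' : Y' ∈ closedSpan G) (h : ∀ Z ∈ G, inner ℂ Z (X - Y) = 0)
    (h' : ∀ Z ∈ G, inner ℂ Z (X - Y') = 0) : Y = Y' := by
  have h1 : ∀ Z ∈ G, inner ℂ Z (Y - Y') = 0 := fun Z hZ => by
    have e : Y - Y' = (X - Y') - (X - Y) := by abel
    rw [e, inner_sub_right, h Z hZ, h' Z hZ, sub_zero]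
  rw [← sub_eq_zero, ← inner_self_eq_zero (𝕜 := ℂ)]
  exact inner_eq_zero_of_mem_closedSpan h1 (sub_mem hY hY')

theorem inner_generating_eq_zero (hζ : IsGenerating ζ ξ)
    (h : ∀ n m ν μ, cov (ξ n ν) (η m μ) = 0) (m n : ℤ) (ν : Fin T) :
    inner ℂ (ζ m) (η n ν) = 0 := by
  rw [hζ.repr, sum_inner]
  refine Finset.sum_eq_zero fun μ _ => ?_
  have := h m n μ ν
  rw [cov_eq_inner] at this
  rw [inner_smul_left, inner_eq_zero_symm.1 this, mul_zero]

theorem inner_functional_eq_zero {a : ℤ → ℂ} {X : Lp ℂ 2 P} (h : ∀ m, inner ℂ (ζ m) X = 0) :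
    inner ℂ X (functional S a ζ) = 0 := by
  rw [functional, inner_sum]
  refine Finset.sum_eq_zero fun m _ => ?_
  rw [inner_smul_right, inner_eq_zero_symm.1 (h m), mul_zero]

/-- For Gladyshev generating sequences the estimates from the observations of `ξ + η` and of
`ζ + θ` coincide. -/
theorem mem_closedSpan_of_gladyshev (hT : 0 < T) (hζ : IsGladyshevGenerating ζ ξ)
    (hθ : IsGladyshevGenerating θ η) (h : ∀ n m ν μ, cov (ξ n ν) (η m μ) = 0) (a : ℤ → ℂ)
    {Y : Lp ℂ 2 P} (hY : Y ∈ closedSpan {Y | ∃ j, j ∉ S ∧ ∃ ν, Y = ξ j ν + η j ν})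
    (hY' : ∀ Z ∈ {Y | ∃ j, j ∉ S ∧ ∃ ν, Y = ξ j ν + η j ν},
      inner ℂ Z (functional S a ζ - Y) = 0) :
    Y ∈ closedSpan {Y | ∃ j, j ∉ S ∧ Y = ζ j + θ j} := by
  have h' : ∀ n m ν μ, cov (η n ν) (ξ m μ) = 0 := fun n m ν μ => by
    have := h m n μ ν
    rw [cov_eq_inner] at this ⊢
    exact inner_eq_zero_symm.1 this
  -- W is the projection on the smaller observation space. It satisfies the normal equations of the
  -- larger one too, and uniqueness of projections gives Y = W.
  obtain ⟨W, hW, hWo⟩ := exists_orthogonal_estimate {Y | ∃ j, j ∉ S ∧ Y = ζ j + θ j}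
    (functional S a ζ)
  have hsum : ∀ j, ζ j + θ j = ∑ ν, rootChar T j ν • (ξ j ν + η j ν) := fun j => by
    simp only [smul_add, Finset.sum_add_distrib, ← hζ.repr, ← hθ.repr]
  have hWbig : W ∈ closedSpan {Y | ∃ j, j ∉ S ∧ ∃ ν, Y = ξ j ν + η j ν} := by
    refine Submodule.topologicalClosure_mono (Submodule.span_le.2 ?_) hW
    rintro _ ⟨j, hj, rfl⟩
    rw [hsum]
    exact Submodule.sum_mem _ fun ν _ => Submodule.smul_mem _ _
      (Submodule.subset_span ⟨j, hj, ν, rfl⟩)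
  have key : ∀ j, j ∉ S → ∀ r ∈ Finset.range T,
      inner ℂ (∑ ν, rootChar T (j + r) ν • (ξ j ν + η j ν)) (functional S a ζ - W) = 0 := by
    intro j hj r hr
    rcases Nat.eq_zero_or_pos r with rfl | hr0
    · rw [Nat.cast_zero, add_zero, ← hsum]
      exact hWo _ ⟨j, hj, rfl⟩
    -- For 0 < r < T the modulated sum is uncorrelated with all of ζ and θ, hence both with A_s ζ
    -- and with W.
    · have hd : ¬ (T : ℤ) ∣ r := fun hd => by
        rw [Int.natCast_dvd_natCast] at hd
        exact absurd (Nat.le_of_dvd hr0 hd) (by simpa using hr)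
      have e : ∑ ν, rootChar T (j + r) ν • (ξ j ν + η j ν) =
          ∑ ν, rootChar T (j + r) ν • ξ j ν + ∑ ν, rootChar T (j + r) ν • η j ν := by
        simp only [smul_add, Finset.sum_add_distrib]
      have e1 : ∀ m, inner ℂ (ζ m) (∑ ν, rootChar T (j + r) ν • (ξ j ν + η j ν)) = 0 := by
        intro m
        rw [e, inner_add_right, hζ.inner_eq_zero hT hd, zero_add, inner_sum]
        refine Finset.sum_eq_zero fun ν _ => ?_
        rw [inner_smul_right, inner_generating_eq_zero hζ.toIsGenerating h, mul_zero]
      have e2 : ∀ m, inner ℂ (θ m) (∑ ν, rootChar T (j + r) ν • (ξ j ν + η j ν)) = 0 := by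
        intro m
        rw [e, inner_add_right, hθ.inner_eq_zero hT hd, add_zero, inner_sum]
        refine Finset.sum_eq_zero fun ν _ => ?_
        rw [inner_smul_right, inner_generating_eq_zero hθ.toIsGenerating h', mul_zero]
      rw [inner_sub_right, inner_functional_eq_zero e1, zero_sub, neg_eq_zero, inner_eq_zero_symm]
      refine inner_eq_zero_of_mem_closedSpan ?_ hW
      rintro _ ⟨m, -, rfl⟩
      rw [inner_add_left, e1, e2, add_zero]
  have hWo' : ∀ Z ∈ {Y | ∃ j, j ∉ S ∧ ∃ ν, Y = ξ j ν + η j ν},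
      inner ℂ Z (functional S a ζ - W) = 0 := by
    rintro _ ⟨j, hj, ν, rfl⟩
    have e := component_eq_sum hT (ξ + η) j ν
    simp only [Pi.add_apply] at e
    rw [e, sum_inner]
    refine Finset.sum_eq_zero fun r hr => ?_
    rw [inner_smul_left, key j hj r hr, mul_zero]
  rw [eq_of_orthogonal_estimate hY hWbig hY' hWo']
  exact hW

/-- `A_s ζ` in the spectral domain. -/
theorem IsSpectralIso.functional_eq {hf : IsWeight f} {Φ : FreqL2 T →L[ℂ] Lp ℂ 2 P}
    (hΦ : IsSpectralIso hf ξ Φ) (hζ : IsGenerating ζ ξ) (a : ℤ → ℂ) :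
    functional S a ζ = Φ (hf.emb ⟨trigPoly (aVec S a), hf.memL2_trigPoly _⟩) := by
  have e : (⟨trigPoly (aVec S a), hf.memL2_trigPoly _⟩ : hf.l2) =
      ∑ j : S, ∑ ν, aVec S a (j, ν) • ⟨expoVec (j : ℤ) ν, hf.memL2_expoVec j ν⟩ := by
    refine Subtype.ext ?_
    change trigPoly (aVec S a) = _
    rw [trigPoly_eq_sum]
    simp
  rw [e]
  simp only [map_sum, map_smul, hΦ.map_expo]
  rw [functional, ← Finset.sum_coe_sort]
  refine Finset.sum_congr rfl fun j _ => ?_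
  rw [hζ.repr, Finset.smul_sum]
  simp only [smul_smul, aVec, vecCoeff]

/-- The normal equations of the problem: p reproduces the correlations of A_s ζ with ξ + η, and q
does not disturb them at times off S. -/
theorem IsSpectralIso.inner_functional {hf : IsWeight f} {hg : IsWeight g}
    {Φ Θ : FreqL2 T →L[ℂ] Lp ℂ 2 P} (hΦ : IsSpectralIso hf ξ Φ)
    (hΘ : IsSpectralIso (hf.add hg) (ξ + η) Θ) (h : ∀ n m ν μ, cov (ξ n ν) (η m μ) = 0)
    (hm : Minimality (f + g)) (hζ : IsGenerating ζ ξ) (a : ℤ → ℂ) (j : ℤ) (hj : j ∉ S)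
    (ν : Fin T) :
    inner ℂ (ξ j ν + η j ν) (functional S a ζ -
      Θ ((hf.add hg).emb ⟨specChar S a f g, memL2_specChar hf hg hm a⟩)) = 0 := by
  have hF := hf.add hg
  have h1 : inner ℂ (ξ j ν + η j ν) (functional S a ζ) =
      pairing f (trigPoly (aVec S a)) (expoVec j ν) := by
    have h0 : inner ℂ (η j ν) (functional S a ζ) = 0 :=
      inner_functional_eq_zero fun m => inner_generating_eq_zero hζ h m j ν
    rw [inner_add_left, h0, add_zero, ← hΦ.map_expo, hΦ.functional_eq hζ, hΦ.inner_map]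
  have hp := memL2_fullChar hf hg hm (aVec S a)
  have hq := memL2_gapChar hf hg hm (cVec S a f g)
  have h2 : inner ℂ (ξ j ν + η j ν)
      (Θ (hF.emb ⟨specChar S a f g, memL2_specChar hf hg hm a⟩)) =
      pairing (f + g) (fullChar f g (aVec S a)) (expoVec j ν) -
        pairing (f + g) (gapChar f g (cVec S a f g)) (expoVec j ν) := by
    have e : (⟨specChar S a f g, memL2_specChar hf hg hm a⟩ : hF.l2) =
        ⟨_, hp⟩ - ⟨_, hq⟩ := Subtype.ext (specChar_eq a)
    have e1 : ξ j ν + η j ν = Θ (hF.emb ⟨expoVec j ν, hF.memL2_expoVec j ν⟩) :=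
      (hΘ.map_expo j ν).symm
    rw [e, map_sub, map_sub, inner_sub_right, e1, hΘ.inner_map, hΘ.inner_map]
  rw [inner_sub_right, h1, h2, pairing_gapChar hm _ hj, pairing_fullChar hm, sub_zero, sub_self]

/-- The mean square error of the estimate with spectral characteristic `u`. -/
theorem IsSpectralIso.meanSqError_eq {hf : IsWeight f} {hg : IsWeight g}
    {Φ Ψ Θ : FreqL2 T →L[ℂ] Lp ℂ 2 P} (hΦ : IsSpectralIso hf ξ Φ) (hΨ : IsSpectralIso hg η Ψ)
    (hΘ : IsSpectralIso (hf.add hg) (ξ + η) Θ) (h : ∀ n m ν μ, cov (ξ n ν) (η m μ) = 0)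
    (hζ : IsGenerating ζ ξ) (a : ℤ → ℂ) {u : ℝ → Fin T → ℂ} (hu : MemL2 (f + g) u) :
    meanSqError (functional S a ζ) (Θ ((hf.add hg).emb ⟨u, hu⟩)) = specError S a f g u := by
  obtain ⟨u1, u2⟩ := hf.memL2_of_add hg hu
  have hA := hf.memL2_trigPoly (aVec S a)
  -- The error splits into a part A_s - u carried by ξ and a part -u carried by η, lying in
  -- orthogonal spans.
  have e : functional S a ζ - Θ ((hf.add hg).emb ⟨u, hu⟩) =
      Φ (hf.emb (⟨_, hA⟩ - ⟨u, u1⟩)) - Ψ (hg.emb ⟨u, u2⟩) := by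
    rw [← hΦ.add hΨ hΘ h u1 u2 hu, hΦ.functional_eq hζ, map_sub, map_sub]
    abel
  have ho : inner ℂ (Φ (hf.emb (⟨_, hA⟩ - ⟨u, u1⟩))) (Ψ (hg.emb ⟨u, u2⟩)) = 0 := by
    refine inner_eq_zero_of_mem_closure_span₂ ?_ (hΦ.mem_closedSpan _) (hΨ.mem_closedSpan _)
    rintro _ ⟨p, rfl⟩ _ ⟨q, rfl⟩
    rw [inner_eq_zero_symm, ← cov_eq_inner]
    exact h _ _ _ _
  rw [PCInterp.meanSqError_eq, e, specError]
  have := norm_sub_sq (𝕜 := ℂ) (Φ (hf.emb (⟨_, hA⟩ - ⟨u, u1⟩))) (Ψ (hg.emb ⟨u, u2⟩))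
  rw [ho, hΦ.norm_map, hΨ.norm_map, hf.norm_emb_sq, hg.norm_emb_sq, map_zero, mul_zero,
    sub_zero] at this
  exact this

end Estimates

end PCInterp

end

/-! ### The interpolation theorem. -/

theorem mainTheorem3 {Ω : Type u} [MeasurableSpace Ω] (P : Measure Ω) [IsProbabilityMeasure P]
    (T : ℕ) (ζ θ : ℤ → Lp ℂ 2 P) (hζ : IsPC T ζ) (hθ : IsPC T θ)
    (hζθ : ∀ n m, cov (ζ n) (θ m) = 0)
    (s : ℕ) (N K : ℕ → ℕ) (hN : N 0 = 0) (hK : K 0 = 0) (S : Finset ℤ) (hS : S = missing s N K)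
    (a : ℤ → ℂ) :
    -- uncorrelated Gladyshev generating sequences exist on an extension of the probability space
    (∃ (Ω' : Type u) (_ : MeasurableSpace Ω') (P' : Measure Ω') (_ : IsProbabilityMeasure P')
      (p : Ω' → Ω) (hp : MeasurePreserving p P' P) (ξ η : ℤ → Fin T → Lp ℂ 2 P'),
      IsGladyshevGenerating (fun n => lift p hp (ζ n)) ξ ∧
      IsGladyshevGenerating (fun n => lift p hp (θ n)) η ∧
      ∀ n m ν μ, cov (ξ n ν) (η m μ) = 0) ∧
    -- the formulas, for uncorrelated generating sequences with densities `f`, `g`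
    (∀ (ξ η : ℤ → Fin T → Lp ℂ 2 P) (f g : ℝ → Matrix (Fin T) (Fin T) ℂ),
      IsGenerating ζ ξ → IsGenerating θ η → (∀ n m ν μ, cov (ξ n ν) (η m μ) = 0) →
      HasSpectralDensity ξ f → HasSpectralDensity η g → Minimality (f + g) →
      -- the Fourier coefficients in the block matrices exist, and `B_s` is invertible
      (∀ ν μ, Integrable (fun x => ((f x + g x)⁻¹) ν μ) freq ∧
        Integrable (fun x => (f x * (f x + g x)⁻¹) ν μ) freq ∧
        Integrable (fun x => (f x * (f x + g x)⁻¹ * g x) ν μ) freq) ∧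
      IsUnit (matB S f g) ∧
      -- the spectral characteristic, in both forms, and the minimal error
      (∀ h, IsSpectralCharacteristic S a f g h ↔ h =ᵐ[freq] specChar S a f g) ∧
      (∀ᵐ x ∂freq, specChar S a f g x = trigPoly (aVec S a) x -
        Matrix.vecMul (Matrix.vecMul (trigPoly (aVec S a) x) (g x) + trigPoly (cVec S a f g) x)
          (f x + g x)⁻¹) ∧
      ((specError S a f g (specChar S a f g) : ℝ) : ℂ) = errorValue S a f g ∧
      -- the orthogonal random measures exist
      (∃ Z, IsSpectralRandomMeasure ξ f Z) ∧ (∃ Z, IsSpectralRandomMeasure η g Z) ∧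
      -- the optimal estimate, its integral representation and its error
      ∃ Ahat : Lp ℂ 2 P,
        (IsGladyshevGenerating ζ ξ → IsGladyshevGenerating θ η →
          IsOptimalLinearEstimate {Y | ∃ j, j ∉ S ∧ Y = ζ j + θ j} (functional S a ζ) Ahat) ∧
        IsOptimalLinearEstimate {Y | ∃ j, j ∉ S ∧ ∃ ν, Y = ξ j ν + η j ν}
          (functional S a ζ) Ahat ∧
        (∀ Zξ Zη, IsSpectralRandomMeasure ξ f Zξ → IsSpectralRandomMeasure η g Zη →
          IsStochIntegral (f + g) (Zξ + Zη) (specChar S a f g) Ahat) ∧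
        ((meanSqError (functional S a ζ) Ahat : ℝ) : ℂ) = errorValue S a f g) := by
  subst hS
  refine ⟨exists_gladyshevGenerating hζ hθ hζθ,
    fun ξ η f g hξ hη hξη hdξ hdη hm => ?_⟩
  have hf := hdξ.isWeight
  have hg := hdη.isWeight
  obtain ⟨Φ, hΦ⟩ := hdξ.exists_iso
  obtain ⟨Ψ, hΨ⟩ := hdη.exists_iso
  obtain ⟨Θ, hΘ⟩ : ∃ Θ, IsSpectralIso (hf.add hg) (ξ + η) Θ := (hdξ.add hdη hξη).exists_iso
  have hs := memL2_specChar (S := missing s N K) hf hg hm a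
  have hortho : ∀ Z ∈ {Y | ∃ j, j ∉ missing s N K ∧ ∃ ν, Y = ξ j ν + η j ν},
      inner ℂ Z (functional (missing s N K) a ζ - Θ ((hf.add hg).emb ⟨_, hs⟩)) = 0 := by
    rintro _ ⟨j, hj, ν, rfl⟩
    exact hΦ.inner_functional (hg := hg) hΘ hξη hm hξ a j hj ν
  have hmem : Θ ((hf.add hg).emb ⟨_, hs⟩) ∈
      closedSpan {Y | ∃ j, j ∉ missing s N K ∧ ∃ ν, Y = ξ j ν + η j ν} := by
    refine map_mem_closure_span Θ ?_
      (((hf.add hg).memL2Minus_iff ⟨_, hs⟩).1 (memL2Minus_specChar hf hg hm a))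
    rintro _ ⟨q, rfl⟩
    exact ⟨q.1, q.1.2, q.2, hΘ.map_expo _ _⟩
  refine ⟨fun ν μ => ⟨(isWeight_inv hf hg hm).integrable ν μ, integrable_mul_inv hf hg hm ν μ,
      integrable_mul_inv_mul hf hg hm ν μ⟩, isUnit_matB hf hg hm,
    isSpectralCharacteristic_iff hf hg hm a, specChar_eq_sub hm a,
    specError_specChar hf hg hm a, hΦ.exists_measure hξ.stationary,
    hΨ.exists_measure hη.stationary, Θ ((hf.add hg).emb ⟨_, hs⟩), fun hGξ hGη => ?_,
    isOptimal_of_inner hmem hortho, fun Zξ Zη hZξ hZη => ?_, ?_⟩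
  · refine isOptimal_of_inner (mem_closedSpan_of_gladyshev hζ.pos hGξ hGη hξη a hmem hortho) ?_
    rintro _ ⟨j, hj, rfl⟩
    have e : ζ j + θ j = ∑ ν, rootChar T j ν • (ξ j ν + η j ν) := by
      simp only [smul_add, Finset.sum_add_distrib, ← hξ.repr, ← hη.repr]
    rw [e, sum_inner]
    refine Finset.sum_eq_zero fun ν _ => ?_
    rw [inner_smul_left, hortho _ ⟨j, hj, ν, rfl⟩, mul_zero]
  -- Both measures are induced by their isometries, and these add up to Θ on step functions, so the
  -- sum of the measures is the one induced by Θ.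
  · refine hΘ.isStochIntegral (fun Δ hΔ ν => ?_) ⟨_, hs⟩
    rw [Pi.add_apply, Pi.add_apply, hZξ.eq_iso hΦ Δ hΔ, hZη.eq_iso hΨ Δ hΔ]
    exact hΦ.add hΨ hΘ hξη _ _ _
  · rw [hΦ.meanSqError_eq hΨ hΘ hξη hξ a hs, specError_specChar hf hg hm a]
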